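/- Let $v_k=(\cos\frac{k\pi}{3},\sin\frac{k\pi}{3})\in\mathbb{R}^2$. The regular hexagon of side length $1$ with centre $c$ and vertices $c+v_0,\dots,c+v_5$ is decomposed into the three unit rhombuses (side length $1$, acute angle $\pi/3$) $\{c+s\,v_k+t\,v_{k+2}: 0\le s,t\le 1\}$, $k=0,2,4$. Take two such hexagons, with centres $(0,0)$ and $(0,\sqrt3)$, so that they share a side. Let $\mathrm D$ be the rhombus $k=0$ of the first hexagon, with vertices $(0,0),(1,0),(\frac12,\frac{\sqrt3}2),(-\frac12,\frac{\sqrt3}2)$, and let $\mathrm I$ be the rhombus $k=2$ of the second hexagon, with vertices $(0,\sqrt3),(-\frac12,\frac{3\sqrt3}2),(-1,\sqrt3),(-\frac12,\frac{\sqrt3}2)$ (or let $(\mathrm D,\mathrm I)$ be the image of this pair under an isometry of the plane). Let $X$ and $Y$ be independent random points, $X$ uniformly distributed in $\mathrm D$ and $Y$ uniformly distributed in $\mathrm I$. Then the Euclidean distance $|X-Y|$ is absolutely continuous with respect to Lebesgue measure on $\mathbb{R}$, and its probability density function is the non-negative function $$ f_{D_4}(d)=2d\left\{ \begin{array}{ll}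 \left(\frac{2\pi}{9\sqrt3}-\frac16\right)d^2 & 0\le d\le\frac{\sqrt3}{2},\\[4pt] \frac{2}{\sqrt3}\left(\frac{2d^2}{3}+1\right)\sin^{-1}\frac{\sqrt3}{2d}-\left(\frac{4\pi}{9\sqrt3}+\frac16\right)d^2+\sqrt{4d^2-3}-\frac{\pi}{\sqrt3} & \frac{\sqrt3}{2}\le d\le 1,\\[4pt] \frac{1}{\sqrt3}\left(\frac{4d^2}{3}+1\right)\sin^{-1}\frac{\sqrt3}{2d}+\left(\frac13-\frac{4\pi}{9\sqrt3}\right)d^2+\frac23\sqrt{4d^2-3}-\frac23 d-\frac{2\pi}{3\sqrt3}+\frac12 & 1\le d\le\sqrt3,\\[4pt] \frac{5}{\sqrt3}\sin^{-1}\frac{\sqrt3}{2d}-\frac{4}{\sqrt3}\left(\frac{d^2}{3}+2\right)\sin^{-1}\frac{\sqrt3}{d}+\left(\frac{4\pi}{9\sqrt3}-\frac13\right)d^2+\frac53\sqrt{4d^2-3}-4\sqrt{d^2-3}-\frac23 d+\frac{8\pi}{3\sqrt3}-\frac12 & \sqrt3\le d\le 2,\\[4pt] \frac{5}{\sqrt3}\sin^{-1}\frac{\sqrt3}{2d}-\frac{2}{\sqrt3}\left(\frac{d^2}{3}+2\right)\sin^{-1}\frac{\sqrt3}{d}+\left(\frac{2\pi}{9\sqrt3}-\frac16\right)d^2+\frac53\sqrt{4d^2-3}-2\sqrt{d^2-3}-2d+\frac{4\pi}{3\sqrt3}-\frac12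 & 2\le d\le\sqrt7,\\[4pt] \left(\frac{2d^2}{3\sqrt3}+3\sqrt3\right)\sin^{-1}\frac{3\sqrt3}{2d}+\left(\frac16-\frac{2\pi}{9\sqrt3}\right)d^2+\frac32\sqrt{4d^2-27}-2d-\sqrt3\,\pi & \sqrt7\le d\le 3,\\[4pt] 0 & \text{otherwise.} \end{array}\right. $$ -/

import Mathlib

open MeasureTheory ProbabilityTheory

noncomputable section

namespace HexDist

/-- The Euclidean plane. -/
abbrev Plane : Type := EuclideanSpace ℝ (Fin 2)

/-- The unit vector at angle `kπ/3`. The regular hexagon with centre `c` and side length `1`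
has the six vertices `c + hexDir k`, `k = 0, …, 5`. -/
def hexDir (k : ℕ) : Plane := !₂[Real.cos (k * (Real.pi / 3)), Real.sin (k * (Real.pi / 3))]

/-- The unit rhombus (side `1`, acute angle `π/3`) with vertices `c`, `c + hexDir k`,
`c + hexDir (k + 1) = c + hexDir k + hexDir (k + 2)` and `c + hexDir (k + 2)`.
For `k = 0, 2, 4` these three rhombuses decompose the unit hexagon with centre `c`. -/
def hexRhombus (c : Plane) (k : ℕ) : Set Plane :=
  (fun x => c + x) '' parallelepiped ![hexDir k, hexDir (k + 2)]

/-- Centre of the first unit hexagon. -/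
def center₁ : Plane := !₂[0, 0]

/-- Centre of the second unit hexagon; it shares with the first one the side
with endpoints `(-1/2, √3/2)` and `(1/2, √3/2)`. -/
def center₂ : Plane := !₂[0, Real.sqrt 3]

/-- The rhombus `D` of the first hexagon: its vertices are
`(0, 0)`, `(1, 0)`, `(1/2, √3/2)`, `(-1/2, √3/2)`. -/
def rhombusD : Set Plane := hexRhombus center₁ 0

/-- The rhombus `I` of the second hexagon: its vertices are
`(0, √3)`, `(-1/2, 3√3/2)`, `(-1, √3)`, `(-1/2, √3/2)`. It meets `D` in the single point
`(-1/2, √3/2)`, which is an endpoint of the side shared by the two hexagons. -/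
def rhombusI : Set Plane := hexRhombus center₂ 2

open Real in
/-- The density function of the random distance `|DI|`. -/
def densityDI (d : ℝ) : ℝ :=
  2 * d *
    (if d < 0 then 0
    else if d ≤ √3 / 2 then
      (2 * π / (9 * √3) - 1 / 6) * d ^ 2
    else if d ≤ 1 then
      2 / √3 * (2 * d ^ 2 / 3 + 1) * arcsin (√3 / (2 * d))
        - (4 * π / (9 * √3) + 1 / 6) * d ^ 2 + √(4 * d ^ 2 - 3) - π / √3
    else if d ≤ √3 then
      1 / √3 * (4 * d ^ 2 / 3 + 1) * arcsin (√3 / (2 * d))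
        + (1 / 3 - 4 * π / (9 * √3)) * d ^ 2 + 2 / 3 * √(4 * d ^ 2 - 3)
        - 2 / 3 * d - 2 * π / (3 * √3) + 1 / 2
    else if d ≤ 2 then
      5 / √3 * arcsin (√3 / (2 * d)) - 4 / √3 * (d ^ 2 / 3 + 2) * arcsin (√3 / d)
        + (4 * π / (9 * √3) - 1 / 3) * d ^ 2 + 5 / 3 * √(4 * d ^ 2 - 3)
        - 4 * √(d ^ 2 - 3) - 2 / 3 * d + 8 * π / (3 * √3) - 1 / 2
    else if d ≤ √7 then
      5 / √3 * arcsin (√3 / (2 * d)) - 2 / √3 * (d ^ 2 / 3 + 2) * arcsin (√3 / d)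
        + (2 * π / (9 * √3) - 1 / 6) * d ^ 2 + 5 / 3 * √(4 * d ^ 2 - 3)
        - 2 * √(d ^ 2 - 3) - 2 * d + 4 * π / (3 * √3) - 1 / 2
    else if d ≤ 3 then
      (2 * d ^ 2 / (3 * √3) + 3 * √3) * arcsin (3 * √3 / (2 * d))
        + (1 / 6 - 2 * π / (9 * √3)) * d ^ 2 + 3 / 2 * √(4 * d ^ 2 - 27)
        - 2 * d - √3 * π
    else 0)

end HexDist

end

/-! The plan is to find the law of the vector Y - X and integrate its density over circles. Resolve
Y - X along and across `hexDir 2`. If X has coordinates (a, b) and Y has coordinates (s, t) in their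
rhombuses, all uniform on [0, 1], the components are x = 1 + m + w and (√3/2) u, where w = s - b, m
= (1 - t + a)/2 and u = a - 1 + t (`dist_rhombus_points`). This choice works because both rhombuses
have a side parallel to `hexDir 2`. The variable w has the tent density. The pair (m, u) is
independent of w and uniform on |u|/2 ≤ m ≤ 1 - |u|/2. Averaging the tent over m gives
`diffDensity`, a signed sum of truncated squares of x ± |u|/2 - k (`lintegral_coordinates`).

In polar coordinates x ∓ u/2 = ρ sin(π/3 ∓ θ) with ρ = 2r/√3. The integral over a circle is
therefore `arcSum`: integrals of max(ρ sin φ - k, 0)² over two arcs adjacent at π/3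
(`integral_diffDensity_polar`, `lintegral_diffDensity_mul`). Each has an explicit antiderivative.
The form of the answer depends on where the solutions of ρ sin φ = k lie relative to the ends of the
arcs, and this changes exactly at r = √3/2, 1, √3, 2, √7, 3. `densityDI_eq` identifies the outcome
with the stated formula.

Nonnegativity comes from the integral representation, not from the formula. The ambient isometry is
removed because it is affine and preserves distances (`cond_isometry_image`). -/

noncomputable section

namespace HexDist

open Real

/-! ### Arc integrals of truncated squares -/

/-- The integral over an arc of the square of the positive part of `ρ sin φ - k`. -/
def truncInt (ρ k α β : ℝ) : ℝ := ∫ φ in α..β, (max (ρ * sin φ - k) 0) ^ 2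

/-- An antiderivative of `(ρ sin φ - k) ^ 2`. -/
def truncPrim (ρ k φ : ℝ) : ℝ :=
  ρ ^ 2 * (φ / 2 - sin φ * cos φ / 2) + 2 * k * ρ * cos φ + k ^ 2 * φ

theorem hasDerivAt_truncPrim (ρ k φ : ℝ) :
    HasDerivAt (truncPrim ρ k) ((ρ * sin φ - k) ^ 2) φ := by
  have h1 := (((hasDerivAt_id φ).div_const 2).sub
    (((hasDerivAt_sin φ).mul (hasDerivAt_cos φ)).div_const 2)).const_mul (ρ ^ 2)
  have h2 := (hasDerivAt_cos φ).const_mul (2 * k * ρ)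
  have h3 := (hasDerivAt_id φ).const_mul (k ^ 2)
  refine ((h1.add h2).add h3).congr_deriv ?_
  have := sin_sq_add_cos_sq φ
  linear_combination (-ρ ^ 2 / 2) * this

theorem continuous_trunc (ρ k : ℝ) : Continuous fun φ : ℝ => (max (ρ * sin φ - k) 0) ^ 2 := by
  fun_prop

theorem truncInt_eq_of_nonneg {ρ k α β : ℝ} (hαβ : α ≤ β)
    (h : ∀ φ ∈ Set.Icc α β, k ≤ ρ * sin φ) :
    truncInt ρ k α β = truncPrim ρ k β - truncPrim ρ k α := by
  rw [← intervalIntegral.integral_eq_sub_of_hasDerivAt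
    (fun φ _ => hasDerivAt_truncPrim ρ k φ) (by apply Continuous.intervalIntegrable; fun_prop)]
  refine intervalIntegral.integral_congr fun φ hφ => ?_
  rw [Set.uIcc_of_le hαβ] at hφ
  simp only [max_eq_left (sub_nonneg.2 (h φ hφ))]

theorem truncInt_eq_zero {ρ k α β : ℝ} (hαβ : α ≤ β)
    (h : ∀ φ ∈ Set.Icc α β, ρ * sin φ ≤ k) : truncInt ρ k α β = 0 := by
  rw [truncInt, intervalIntegral.integral_congr (g := fun _ => 0), intervalIntegral.integral_zero]
  intro φ hφ
  rw [Set.uIcc_of_le hαβ] at hφ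
  simp only [max_eq_right (sub_nonpos.2 (h φ hφ))]
  norm_num

theorem truncInt_eq_zero_of_le {ρ k α β : ℝ} (hρ : 0 ≤ ρ) (hk : ρ ≤ k) (hαβ : α ≤ β) :
    truncInt ρ k α β = 0 :=
  truncInt_eq_zero hαβ fun φ _ => by nlinarith [sin_le_one φ]

theorem truncInt_add (ρ k α β γ : ℝ) :
    truncInt ρ k α β + truncInt ρ k β γ = truncInt ρ k α γ :=
  intervalIntegral.integral_add_adjacent_intervals
    ((continuous_trunc ρ k).intervalIntegrable _ _) ((continuous_trunc ρ k).intervalIntegrable _ _)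

theorem le_mul_sin {ρ k φ : ℝ} (hρ : 0 < ρ) (hk : 0 ≤ k) (hkρ : k ≤ ρ)
    (h1 : arcsin (k / ρ) ≤ φ) (h2 : φ ≤ π - arcsin (k / ρ)) : k ≤ ρ * sin φ := by
  have h0 : 0 ≤ arcsin (k / ρ) := arcsin_nonneg.2 (by positivity)
  have hs : sin (arcsin (k / ρ)) = k / ρ :=
    sin_arcsin (by have : 0 ≤ k / ρ := by positivity
                   linarith) ((div_le_one hρ).2 hkρ)
  have key : k / ρ ≤ sin φ := by
    rw [← hs]
    rcases le_total φ (π / 2) with h | h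
    · exact sin_le_sin_of_le_of_le_pi_div_two (by linarith [pi_pos]) h h1
    · rw [← sin_pi_sub φ]
      exact sin_le_sin_of_le_of_le_pi_div_two (by linarith [pi_pos]) (by linarith) (by linarith)
  rw [div_le_iff₀ hρ] at key
  linarith

theorem mul_sin_le {ρ k φ : ℝ} (hρ : 0 < ρ) (hk : 0 ≤ k) (hkρ : k ≤ ρ)
    (h1 : -(π / 2) ≤ φ) (h2 : φ ≤ arcsin (k / ρ)) : ρ * sin φ ≤ k := by
  have hs : sin (arcsin (k / ρ)) = k / ρ :=
    sin_arcsin (by have : 0 ≤ k / ρ := by positivity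
                   linarith) ((div_le_one hρ).2 hkρ)
  have key : sin φ ≤ k / ρ := by
    rw [← hs]
    exact sin_le_sin_of_le_of_le_pi_div_two h1 (arcsin_le_pi_div_two _) h2
  rw [le_div_iff₀ hρ] at key
  linarith

theorem truncInt_inside {ρ k α β : ℝ} (hρ : 0 < ρ) (hk : 0 ≤ k) (hkρ : k ≤ ρ) (hαβ : α ≤ β)
    (h1 : arcsin (k / ρ) ≤ α) (h2 : β ≤ π - arcsin (k / ρ)) :
    truncInt ρ k α β = truncPrim ρ k β - truncPrim ρ k α :=
  truncInt_eq_of_nonneg hαβ fun _ hφ =>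
    le_mul_sin hρ hk hkρ (h1.trans hφ.1) (hφ.2.trans h2)

/-- The integrand vanishes until ρ sin φ reaches k, so the arc effectively starts at `arcsin (k /
ρ)`. -/
theorem truncInt_left {ρ k α β : ℝ} (hρ : 0 < ρ) (hk : 0 ≤ k) (hkρ : k ≤ ρ)
    (h0 : -(π / 2) ≤ α) (h1 : α ≤ arcsin (k / ρ)) (h2 : arcsin (k / ρ) ≤ β)
    (h3 : β ≤ π - arcsin (k / ρ)) :
    truncInt ρ k α β = truncPrim ρ k β - truncPrim ρ k (arcsin (k / ρ)) := by
  rw [← truncInt_add ρ k α (arcsin (k / ρ)) β, truncInt_inside hρ hk hkρ h2 le_rfl h3,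
    truncInt_eq_zero h1 fun φ hφ => mul_sin_le hρ hk hkρ (h0.trans hφ.1) hφ.2, zero_add]

/-- The arc contains the whole interval on which ρ sin φ exceeds k, so only its two crossing angles
matter. -/
theorem truncInt_across {ρ k α β : ℝ} (hρ : 0 < ρ) (hk : 0 ≤ k) (hkρ : k ≤ ρ)
    (h0 : -(π / 2) ≤ α) (h1 : α ≤ arcsin (k / ρ)) (h3 : π - arcsin (k / ρ) ≤ β)
    (h4 : β ≤ π + π / 2) :
    truncInt ρ k α β =
      truncPrim ρ k (π - arcsin (k / ρ)) - truncPrim ρ k (arcsin (k / ρ)) := by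
  have h5 := arcsin_le_pi_div_two (k / ρ)
  rw [← truncInt_add ρ k α (π - arcsin (k / ρ)) β,
    truncInt_left hρ hk hkρ h0 h1 (by linarith) le_rfl,
    truncInt_eq_zero h3 fun φ hφ => ?_, add_zero]
  rw [← sin_pi_sub φ]
  exact mul_sin_le hρ hk hkρ (by linarith [hφ.2]) (by linarith [hφ.1])

/-! ### The arc sum, threshold angles and values at the ends of the arcs -/

/-- The combination of arc integrals which gives the angular integral of the density. -/
def arcSum (ρ θ : ℝ) : ℝ :=
  truncInt ρ 0 (π / 3 - θ) (π / 3) - 2 * truncInt ρ 1 (π / 3 - θ) (π / 3)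
    + truncInt ρ 2 (π / 3 - θ) (π / 3) - truncInt ρ 1 (π / 3) (π / 3 + θ)
    + 2 * truncInt ρ 2 (π / 3) (π / 3 + θ) - truncInt ρ 3 (π / 3) (π / 3 + θ)

/-- The largest polar angle met by the support of the difference at distance `r`. -/
def maxAngle (r : ℝ) : ℝ := if r ≤ 1 then π / 3 else arcsin (√3 / (2 * r))

/-- The antiderivative at scale `2 r / √3`, linear in the angle and polynomial in
the Cartesian coordinates. -/
theorem truncPrim_eq (r k φ : ℝ) :
    truncPrim (2 * r / √3) k φ = (2 * r ^ 2 / 3 + k ^ 2) * φ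
      - 2 / 3 * (r * sin φ) * (r * cos φ) + 4 * k * √3 / 3 * (r * cos φ) := by
  have h3 : √3 * √3 = 3 := mul_self_sqrt (by norm_num)
  have h3' : √3 ≠ 0 := by positivity
  have e : 2 * r / √3 = 2 * r * √3 / 3 := by field_simp; linear_combination (-r) * h3
  rw [truncPrim, e]
  linear_combination (4 * r ^ 2 / 9 * (φ / 2 - sin φ * cos φ / 2)) * h3

theorem div_scale (r k : ℝ) : k / (2 * r / √3) = k * √3 / (2 * r) := by
  rw [div_div_eq_mul_div]

theorem mul_sin_arcsin_div {r a : ℝ} (hr : 0 < r) (ha : 0 ≤ a) (h : a ≤ r) :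
    r * sin (arcsin (a / r)) = a := by
  rw [sin_arcsin (by have : 0 ≤ a / r := by positivity
                     linarith) ((div_le_one hr).2 h)]
  field_simp

theorem mul_cos_arcsin_div {r a : ℝ} (hr : 0 < r) :
    r * cos (arcsin (a / r)) = √(r ^ 2 - a ^ 2) := by
  rw [cos_arcsin, show r ^ 2 - a ^ 2 = r ^ 2 * (1 - (a / r) ^ 2) by field_simp,
    sqrt_mul (by positivity), sqrt_sq hr.le]

theorem sqrt_three_facts : √3 * √3 = 3 ∧ 1.732 < √3 ∧ √3 < 1.7321 := by
  refine ⟨mul_self_sqrt (by norm_num), ?_, ?_⟩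
  · rw [lt_sqrt] <;> norm_num
  · rw [sqrt_lt'] <;> norm_num

theorem sqrt_seven_facts : √7 * √7 = 7 ∧ 2.645 < √7 ∧ √7 < 2.646 := by
  refine ⟨mul_self_sqrt (by norm_num), ?_, ?_⟩
  · rw [lt_sqrt] <;> norm_num
  · rw [sqrt_lt'] <;> norm_num

theorem le_scale {r k : ℝ} (h : k * √3 ≤ 2 * r) : k ≤ 2 * r / √3 := by
  rwa [le_div_iff₀ (by positivity)]

theorem scale_le {r k : ℝ} (h : 2 * r ≤ k * √3) : 2 * r / √3 ≤ k := by
  rwa [div_le_iff₀ (by positivity)]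

/-- The acute solution `φ` of `ρ sin φ = k`, where `ρ = 2 r / √3`. -/
def lineAngle (r k : ℝ) : ℝ := arcsin (k / (2 * r / √3))

theorem lineAngle_eq (r k : ℝ) : lineAngle r k = arcsin (k * √3 / 2 / r) := by
  rw [lineAngle, div_scale, div_div]

theorem lineAngle_nonneg {r k : ℝ} (hr : 0 < r) (hk : 0 ≤ k) : 0 ≤ lineAngle r k :=
  arcsin_nonneg.2 (by positivity)

theorem lineAngle_le_pi_div_two (r k : ℝ) : lineAngle r k ≤ π / 2 := arcsin_le_pi_div_two _

theorem lineAngle_le {r k θ : ℝ} (hr : 0 < r) (h1 : 0 ≤ θ) (h2 : θ ≤ π / 2)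
    (h : k * √3 / 2 ≤ r * sin θ) : lineAngle r k ≤ θ := by
  rw [lineAngle_eq]
  rcases h2.lt_or_eq with h2 | rfl
  · rw [arcsin_le_iff_le_sin' ⟨by linarith [pi_pos], h2⟩, div_le_iff₀ hr]
    linarith
  · exact arcsin_le_pi_div_two _

theorem le_lineAngle {r k θ : ℝ} (hr : 0 < r) (h1 : 0 ≤ θ) (h2 : θ ≤ π / 2)
    (h : r * sin θ ≤ k * √3 / 2) : θ ≤ lineAngle r k := by
  rw [lineAngle_eq, le_arcsin_iff_sin_le' ⟨by linarith [pi_pos], h2⟩, le_div_iff₀ hr]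
  linarith

theorem mul_sin_lineAngle {r k : ℝ} (hr : 0 < r) (hk : 0 ≤ k) (h : k * √3 ≤ 2 * r) :
    r * sin (lineAngle r k) = k * √3 / 2 := by
  rw [lineAngle_eq, mul_sin_arcsin_div hr (by positivity) (by linarith)]

theorem mul_cos_lineAngle {r : ℝ} (k : ℝ) (hr : 0 < r) :
    r * cos (lineAngle r k) = √(4 * r ^ 2 - 3 * k ^ 2) / 2 := by
  have h3 : √3 * √3 = 3 := mul_self_sqrt (by norm_num)
  rw [lineAngle_eq, mul_cos_arcsin_div hr, show 4 * r ^ 2 - 3 * k ^ 2 =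
    2 ^ 2 * (r ^ 2 - (k * √3 / 2) ^ 2) by linear_combination k ^ 2 * h3,
    sqrt_mul (by positivity), sqrt_sq (by norm_num)]
  ring

/-- This and the next three lemmas give the Cartesian coordinates of the outer ends of the two arcs
when r ≥ 1. They come from rotating the point (√(4r² - 3)/2, ±√3/2) by π/3. -/
theorem mul_sin_add {r : ℝ} (hr : 0 < r) (h : √3 ≤ 2 * r) :
    r * sin (π / 3 + lineAngle r 1) = √3 / 4 * (√(4 * r ^ 2 - 3) + 1) := by
  have h1 := mul_sin_lineAngle hr zero_le_one (by linarith)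
  have h2 := mul_cos_lineAngle 1 hr
  rw [sin_add, sin_pi_div_three, cos_pi_div_three]
  norm_num at h1 h2
  linear_combination √3 / 2 * h2 + 1 / 2 * h1

theorem mul_sin_sub {r : ℝ} (hr : 0 < r) (h : √3 ≤ 2 * r) :
    r * sin (π / 3 - lineAngle r 1) = √3 / 4 * (√(4 * r ^ 2 - 3) - 1) := by
  have h1 := mul_sin_lineAngle hr zero_le_one (by linarith)
  have h2 := mul_cos_lineAngle 1 hr
  rw [sin_sub, sin_pi_div_three, cos_pi_div_three]
  norm_num at h1 h2
  linear_combination √3 / 2 * h2 - 1 / 2 * h1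

theorem mul_cos_add {r : ℝ} (hr : 0 < r) (h : √3 ≤ 2 * r) :
    r * cos (π / 3 + lineAngle r 1) = (√(4 * r ^ 2 - 3) - 3) / 4 := by
  have h1 := mul_sin_lineAngle hr zero_le_one (by linarith)
  have h2 := mul_cos_lineAngle 1 hr
  have h3 : √3 * √3 = 3 := mul_self_sqrt (by norm_num)
  rw [cos_add, sin_pi_div_three, cos_pi_div_three]
  norm_num at h1 h2
  linear_combination 1 / 2 * h2 - √3 / 2 * h1 - 1 / 4 * h3

theorem mul_cos_sub {r : ℝ} (hr : 0 < r) (h : √3 ≤ 2 * r) :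
    r * cos (π / 3 - lineAngle r 1) = (√(4 * r ^ 2 - 3) + 3) / 4 := by
  have h1 := mul_sin_lineAngle hr zero_le_one (by linarith)
  have h2 := mul_cos_lineAngle 1 hr
  have h3 : √3 * √3 = 3 := mul_self_sqrt (by norm_num)
  rw [cos_sub, sin_pi_div_three, cos_pi_div_three]
  norm_num at h1 h2
  linear_combination 1 / 2 * h2 + √3 / 2 * h1 + 1 / 4 * h3

theorem truncPrim_zero_zero (r : ℝ) : truncPrim (2 * r / √3) 0 0 = 0 := by
  simp [truncPrim]

theorem truncPrim_third (r k : ℝ) :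
    truncPrim (2 * r / √3) k (π / 3) = (2 * r ^ 2 / 3 + k ^ 2) * (π / 3)
      - √3 / 6 * r ^ 2 + 2 * k * √3 / 3 * r := by
  rw [truncPrim_eq, sin_pi_div_three, cos_pi_div_three]
  ring

theorem truncPrim_add {r : ℝ} (k : ℝ) (hr : 0 < r) (h : √3 ≤ 2 * r) :
    truncPrim (2 * r / √3) k (π / 3 + lineAngle r 1) =
      (2 * r ^ 2 / 3 + k ^ 2) * (π / 3 + lineAngle r 1)
      - √3 / 24 * (4 * r ^ 2 - 6 - 2 * √(4 * r ^ 2 - 3))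
      + k * √3 / 3 * (√(4 * r ^ 2 - 3) - 3) := by
  have h3 : √3 * √3 = 3 := mul_self_sqrt (by norm_num)
  have hq : √(4 * r ^ 2 - 3) * √(4 * r ^ 2 - 3) = 4 * r ^ 2 - 3 :=
    mul_self_sqrt (by nlinarith [sqrt_nonneg 3])
  rw [truncPrim_eq, mul_sin_add hr h, mul_cos_add hr h]
  linear_combination -√3 / 24 * hq

theorem truncPrim_sub {r : ℝ} (k : ℝ) (hr : 0 < r) (h : √3 ≤ 2 * r) :
    truncPrim (2 * r / √3) k (π / 3 - lineAngle r 1) =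
      (2 * r ^ 2 / 3 + k ^ 2) * (π / 3 - lineAngle r 1)
      - √3 / 24 * (4 * r ^ 2 - 6 + 2 * √(4 * r ^ 2 - 3))
      + k * √3 / 3 * (√(4 * r ^ 2 - 3) + 3) := by
  have h3 : √3 * √3 = 3 := mul_self_sqrt (by norm_num)
  have hq : √(4 * r ^ 2 - 3) * √(4 * r ^ 2 - 3) = 4 * r ^ 2 - 3 :=
    mul_self_sqrt (by nlinarith [sqrt_nonneg 3])
  rw [truncPrim_eq, mul_sin_sub hr h, mul_cos_sub hr h]
  linear_combination -√3 / 24 * hq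

theorem truncPrim_lineAngle {r k : ℝ} (hr : 0 < r) (hk : 0 ≤ k) (h : k * √3 ≤ 2 * r) :
    truncPrim (2 * r / √3) k (lineAngle r k) =
      (2 * r ^ 2 / 3 + k ^ 2) * lineAngle r k + k * √3 / 2 * √(4 * r ^ 2 - 3 * k ^ 2) := by
  rw [truncPrim_eq, mul_sin_lineAngle hr hk h, mul_cos_lineAngle k hr]
  ring

theorem truncPrim_pi_sub {r k : ℝ} (hr : 0 < r) (hk : 0 ≤ k) (h : k * √3 ≤ 2 * r) :
    truncPrim (2 * r / √3) k (π - lineAngle r k) =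
      (2 * r ^ 2 / 3 + k ^ 2) * (π - lineAngle r k)
        - k * √3 / 2 * √(4 * r ^ 2 - 3 * k ^ 2) := by
  rw [truncPrim_eq, sin_pi_sub, cos_pi_sub, mul_neg, mul_sin_lineAngle hr hk h,
    mul_cos_lineAngle k hr]
  ring

theorem arcsin_eq_lineAngle_one (r : ℝ) : arcsin (√3 / (2 * r)) = lineAngle r 1 := by
  rw [lineAngle_eq, one_mul, div_div]

theorem arcsin_eq_lineAngle_two (r : ℝ) : arcsin (√3 / r) = lineAngle r 2 := by
  rw [lineAngle_eq, mul_div_cancel_left₀ _ (two_ne_zero' ℝ)]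

theorem arcsin_eq_lineAngle_three (r : ℝ) : arcsin (3 * √3 / (2 * r)) = lineAngle r 3 := by
  rw [lineAngle_eq, div_div]

theorem sqrt_twelve (r : ℝ) : √(4 * r ^ 2 - 3 * 2 ^ 2) = 2 * √(r ^ 2 - 3) := by
  rw [show 4 * r ^ 2 - 3 * 2 ^ 2 = 2 ^ 2 * (r ^ 2 - 3) by ring, sqrt_mul (by norm_num),
    sqrt_sq (by norm_num)]

/-! ### Values of the arc sum on each range of r -/

theorem truncInt_zero_third {r : ℝ} (hr : 0 < r) :
    truncInt (2 * r / √3) 0 0 (π / 3) = truncPrim (2 * r / √3) 0 (π / 3) := by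
  rw [truncInt_eq_of_nonneg (by positivity), truncPrim_zero_zero, sub_zero]
  intro φ hφ
  have := sin_nonneg_of_nonneg_of_le_pi hφ.1 (by linarith [hφ.2, pi_pos])
  positivity

/-- Here ρ ≤ 1, so only the square with k = 0 is ever positive. -/
theorem arcSum_of_le_half {r : ℝ} (hr : 0 < r) (h : 2 * r ≤ √3) :
    arcSum (2 * r / √3) (π / 3) = 2 * r ^ 2 / 3 * (π / 3) - √3 / 6 * r ^ 2 := by
  have hp := pi_pos
  have h1 : 2 * r / √3 ≤ 1 := scale_le (by linarith)
  have h0 : (0 : ℝ) ≤ 2 * r / √3 := by positivity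
  rw [arcSum, sub_self, truncInt_zero_third hr, truncPrim_third]
  repeat rw [truncInt_eq_zero_of_le h0 (by linarith) (by linarith)]
  ring

/-- Level 1 is exceeded only between `lineAngle r 1` ≥ π/3 and its supplement. That interval lies
inside the upper arc [π/3, 2π/3]. -/
theorem arcSum_of_le_one {r : ℝ} (h : √3 ≤ 2 * r) (h' : r ≤ 1) :
    arcSum (2 * r / √3) (π / 3) = 2 * r ^ 2 / 3 * (π / 3) - √3 / 6 * r ^ 2
      - ((2 * r ^ 2 / 3 + 1) * (π - 2 * lineAngle r 1) - √3 * √(4 * r ^ 2 - 3)) := by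
  have hp := pi_pos
  obtain ⟨h3, h31, h32⟩ := sqrt_three_facts
  have hr : 0 < r := by linarith
  have hρ : 0 < 2 * r / √3 := by positivity
  have h1 : 1 ≤ 2 * r / √3 := le_scale (by linarith)
  have h2 : 2 * r / √3 ≤ 2 := scale_le (by linarith)
  have hθ : π / 3 ≤ lineAngle r 1 := le_lineAngle hr (by linarith) (by linarith) (by
    rw [sin_pi_div_three]; nlinarith)
  rw [arcSum, sub_self, truncInt_zero_third hr, truncPrim_third,
    truncInt_across (α := π / 3) (k := 1) hρ zero_le_one h1 (by linarith) hθ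
      (show π - lineAngle r 1 ≤ _ by linarith) (by linarith),
    truncInt_eq_zero (k := 1) (by positivity) fun φ hφ =>
      mul_sin_le hρ zero_le_one h1 (by linarith [hφ.1]) (hφ.2.trans hθ)]
  repeat rw [truncInt_eq_zero_of_le hρ.le (by linarith) (by linarith)]
  rw [← lineAngle, truncPrim_pi_sub hr zero_le_one (by linarith),
    truncPrim_lineAngle hr zero_le_one (by linarith)]
  norm_num
  ring

theorem lineAngle_one_le {r : ℝ} (h : 1 ≤ r) : lineAngle r 1 ≤ π / 3 := by
  have hp := pi_pos
  refine lineAngle_le (by linarith) (by linarith) (by linarith) ?_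
  rw [sin_pi_div_three]
  nlinarith [sqrt_nonneg 3]

theorem lineAngle_one_le_sixth {r : ℝ} (h : √3 ≤ r) : lineAngle r 1 ≤ π / 6 := by
  have hp := pi_pos
  have := sqrt_three_facts
  refine lineAngle_le (by linarith) (by linarith) (by linarith) ?_
  rw [sin_pi_div_six]
  linarith

theorem truncInt_zero_arc {r : ℝ} (h : 1 ≤ r) :
    truncInt (2 * r / √3) 0 (π / 3 - lineAngle r 1) (π / 3) =
      2 * r ^ 2 / 3 * lineAngle r 1 - √3 / 6 * r ^ 2
        + √3 / 24 * (4 * r ^ 2 - 6 + 2 * √(4 * r ^ 2 - 3)) := by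
  have h0 := lineAngle_nonneg (r := r) (k := 1) (by linarith) (by linarith)
  have h1 := lineAngle_one_le h
  have hp := pi_pos
  have := sqrt_three_facts
  rw [truncInt_eq_of_nonneg (by linarith), truncPrim_third,
    truncPrim_sub 0 (by linarith) (by linarith)]
  · ring
  · intro φ hφ
    have : 0 ≤ sin φ :=
      sin_nonneg_of_nonneg_of_le_pi (by linarith [hφ.1]) (by linarith [hφ.2, pi_pos])
    positivity

theorem truncInt_one_upper {r : ℝ} (h : 1 ≤ r) :
    truncInt (2 * r / √3) 1 (π / 3) (π / 3 + lineAngle r 1) =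
      (2 * r ^ 2 / 3 + 1) * lineAngle r 1
      - √3 / 24 * (4 * r ^ 2 - 6 - 2 * √(4 * r ^ 2 - 3))
      + √3 / 3 * (√(4 * r ^ 2 - 3) - 3) + √3 / 6 * r ^ 2 - 2 * √3 / 3 * r := by
  have h0 := lineAngle_nonneg (r := r) (k := 1) (by linarith) (by linarith)
  have h1 := lineAngle_one_le h
  have hp := pi_pos
  have := sqrt_three_facts
  have hr : 0 < r := by linarith
  rw [truncInt_inside (by positivity) zero_le_one (le_scale (by linarith)) (by linarith) h1
    (show _ ≤ π - lineAngle r 1 by linarith), truncPrim_third,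
    truncPrim_add 1 (by linarith) (by linarith)]
  ring

theorem truncInt_one_lower {r : ℝ} (h : √3 ≤ r) :
    truncInt (2 * r / √3) 1 (π / 3 - lineAngle r 1) (π / 3) =
      (2 * r ^ 2 / 3 + 1) * lineAngle r 1 - √3 / 6 * r ^ 2 + 2 * √3 / 3 * r
      + √3 / 24 * (4 * r ^ 2 - 6 + 2 * √(4 * r ^ 2 - 3))
      - √3 / 3 * (√(4 * r ^ 2 - 3) + 3) := by
  have := sqrt_three_facts
  have h0 := lineAngle_nonneg (r := r) (k := 1) (by linarith) (by linarith)
  have h1 := lineAngle_one_le_sixth h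
  have hp := pi_pos
  have hr : 0 < r := by linarith
  rw [truncInt_inside (by positivity) zero_le_one (le_scale (by linarith)) (by linarith)
    (show lineAngle r 1 ≤ _ by linarith)
    (show _ ≤ π - lineAngle r 1 by linarith), truncPrim_third,
    truncPrim_sub 1 (by linarith) (by linarith)]
  ring

/-- Level 1 is crossed inside the lower arc, because π/6 ≤ `lineAngle r 1` ≤ π/3, and is exceeded on
all of the upper arc. Levels 2 and 3 are out of reach since ρ ≤ 2. -/
theorem arcSum_of_le_sqrt_three {r : ℝ} (h : 1 ≤ r) (h' : r ≤ √3) :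
    arcSum (2 * r / √3) (lineAngle r 1) = 2 * r ^ 2 / 3 * lineAngle r 1 - √3 / 6 * r ^ 2
        + √3 / 24 * (4 * r ^ 2 - 6 + 2 * √(4 * r ^ 2 - 3))
      - 2 * ((2 * r ^ 2 / 3 + 1) * (π / 3 - lineAngle r 1) - √3 / 6 * r ^ 2
        + 2 * √3 / 3 * r - √3 / 2 * √(4 * r ^ 2 - 3))
      - ((2 * r ^ 2 / 3 + 1) * lineAngle r 1
      - √3 / 24 * (4 * r ^ 2 - 6 - 2 * √(4 * r ^ 2 - 3))
      + √3 / 3 * (√(4 * r ^ 2 - 3) - 3) + √3 / 6 * r ^ 2 - 2 * √3 / 3 * r) := by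
  have hp := pi_pos
  obtain ⟨h3, h31, h32⟩ := sqrt_three_facts
  have hr : 0 < r := by linarith
  have hρ : 0 < 2 * r / √3 := by positivity
  have h1 : 1 ≤ 2 * r / √3 := le_scale (by linarith)
  have h2 : 2 * r / √3 ≤ 2 := scale_le (by linarith)
  have hθ0 := lineAngle_nonneg (r := r) (k := 1) hr zero_le_one
  have hθ := lineAngle_one_le h
  have hθ' : π / 6 ≤ lineAngle r 1 := le_lineAngle hr (by linarith) (by linarith) (by
    rw [sin_pi_div_six]; linarith)
  rw [arcSum, truncInt_zero_arc h, truncInt_one_upper h, truncInt_left (k := 1) hρ zero_le_one h1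
    (by linarith) (show _ ≤ lineAngle r 1 by linarith) hθ (show _ ≤ π - lineAngle r 1 by linarith),
    ← lineAngle, truncPrim_third, truncPrim_lineAngle hr zero_le_one (by linarith)]
  repeat rw [truncInt_eq_zero_of_le hρ.le (by linarith) (by linarith)]
  norm_num
  ring

theorem sqrt_ge {r a : ℝ} (h : a ^ 2 ≤ 4 * r ^ 2 - 3) : a ≤ √(4 * r ^ 2 - 3) :=
  le_sqrt_of_sq_le h

theorem sqrt_le' {r a : ℝ} (ha : 0 ≤ a) (h : 4 * r ^ 2 - 3 ≤ a ^ 2) : √(4 * r ^ 2 - 3) ≤ a :=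
  (sqrt_le_left ha).2 h

/-- Level 1 is now exceeded on both arcs. Level 2 is crossed inside the upper arc, and level 3 is
out of reach. -/
theorem arcSum_of_le_two {r : ℝ} (h : √3 ≤ r) (h' : r ≤ 2) :
    arcSum (2 * r / √3) (lineAngle r 1) = 2 * r ^ 2 / 3 * lineAngle r 1 - √3 / 6 * r ^ 2
        + √3 / 24 * (4 * r ^ 2 - 6 + 2 * √(4 * r ^ 2 - 3))
      - 2 * ((2 * r ^ 2 / 3 + 1) * lineAngle r 1 - √3 / 6 * r ^ 2 + 2 * √3 / 3 * r
        + √3 / 24 * (4 * r ^ 2 - 6 + 2 * √(4 * r ^ 2 - 3))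
        - √3 / 3 * (√(4 * r ^ 2 - 3) + 3))
      - ((2 * r ^ 2 / 3 + 1) * lineAngle r 1
        - √3 / 24 * (4 * r ^ 2 - 6 - 2 * √(4 * r ^ 2 - 3))
        + √3 / 3 * (√(4 * r ^ 2 - 3) - 3) + √3 / 6 * r ^ 2 - 2 * √3 / 3 * r)
      + 2 * ((2 * r ^ 2 / 3 + 4) * (π / 3 + lineAngle r 1 - lineAngle r 2)
        - √3 / 24 * (4 * r ^ 2 - 6 - 2 * √(4 * r ^ 2 - 3))
        + 2 * √3 / 3 * (√(4 * r ^ 2 - 3) - 3) - 2 * √3 * √(r ^ 2 - 3)) := by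
  have hp := pi_pos
  obtain ⟨h3, h31, h32⟩ := sqrt_three_facts
  have hr : 0 < r := by linarith
  have hρ : 0 < 2 * r / √3 := by positivity
  have h1 : 2 ≤ 2 * r / √3 := le_scale (by linarith)
  have h2 : 2 * r / √3 ≤ 3 := scale_le (by linarith)
  have hθ0 := lineAngle_nonneg (r := r) (k := 1) hr zero_le_one
  have hθ := lineAngle_one_le_sixth h
  have hφ : π / 3 ≤ lineAngle r 2 := le_lineAngle hr (by linarith) (by linarith) (by
    rw [sin_pi_div_three]; nlinarith)
  have hφ' : lineAngle r 2 ≤ π / 3 + lineAngle r 1 :=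
    lineAngle_le hr (by linarith) (by linarith) (by
      rw [mul_sin_add hr (by linarith)]
      -- The upper arc ends above level 2 exactly when √(4r² - 3) ≥ 3, that is, r² ≥ 3.
      nlinarith [sqrt_ge (r := r) (a := 3) (by nlinarith)])
  have hφ2 := lineAngle_le_pi_div_two r 2
  rw [arcSum, truncInt_zero_arc (by linarith), truncInt_one_upper (by linarith),
    truncInt_one_lower h, truncInt_eq_zero (k := 2) (α := π / 3 - lineAngle r 1) (by linarith)
      fun φ hφ' => mul_sin_le hρ zero_le_two h1 (by linarith [hφ'.1]) (hφ'.2.trans hφ),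
    truncInt_left (k := 2) hρ zero_le_two h1
    (by linarith) hφ hφ' (show _ ≤ π - lineAngle r 2 by linarith),
    ← lineAngle, truncPrim_add 2 hr (by linarith), truncPrim_lineAngle hr zero_le_two (by linarith),
    truncInt_eq_zero_of_le hρ.le h2 (by linarith), sqrt_twelve]
  ring

/-- The crossing of level 2 has moved into the lower arc. Level 3 may be below ρ, but it is not
reached on the upper arc. -/
theorem arcSum_of_le_sqrt_seven {r : ℝ} (h : 2 ≤ r) (h' : r ≤ √7) :
    arcSum (2 * r / √3) (lineAngle r 1) = 2 * r ^ 2 / 3 * lineAngle r 1 - √3 / 6 * r ^ 2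
        + √3 / 24 * (4 * r ^ 2 - 6 + 2 * √(4 * r ^ 2 - 3))
      - 2 * ((2 * r ^ 2 / 3 + 1) * lineAngle r 1 - √3 / 6 * r ^ 2 + 2 * √3 / 3 * r
        + √3 / 24 * (4 * r ^ 2 - 6 + 2 * √(4 * r ^ 2 - 3))
        - √3 / 3 * (√(4 * r ^ 2 - 3) + 3))
      + ((2 * r ^ 2 / 3 + 4) * (π / 3 - lineAngle r 2) - √3 / 6 * r ^ 2 + 4 * √3 / 3 * r
        - 2 * √3 * √(r ^ 2 - 3))
      - ((2 * r ^ 2 / 3 + 1) * lineAngle r 1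
        - √3 / 24 * (4 * r ^ 2 - 6 - 2 * √(4 * r ^ 2 - 3))
        + √3 / 3 * (√(4 * r ^ 2 - 3) - 3) + √3 / 6 * r ^ 2 - 2 * √3 / 3 * r)
      + 2 * ((2 * r ^ 2 / 3 + 4) * lineAngle r 1
        - √3 / 24 * (4 * r ^ 2 - 6 - 2 * √(4 * r ^ 2 - 3))
        + 2 * √3 / 3 * (√(4 * r ^ 2 - 3) - 3) + √3 / 6 * r ^ 2 - 4 * √3 / 3 * r) := by
  have hp := pi_pos
  obtain ⟨h3, h31, h32⟩ := sqrt_three_facts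
  have hr : 0 < r := by linarith
  have hρ : 0 < 2 * r / √3 := by positivity
  have h1 : 2 ≤ 2 * r / √3 := le_scale (by linarith)
  have h7 : r ^ 2 ≤ 7 := by
    have := sqrt_seven_facts
    nlinarith
  -- This bound, equivalent to r² ≤ 7, decides two things: the lower arc starts below level 2, and
  -- the upper arc ends below level 3.
  have hc : √(4 * r ^ 2 - 3) ≤ 5 := sqrt_le' (by norm_num) (by linarith)
  have hc' : 3 ≤ √(4 * r ^ 2 - 3) := sqrt_ge (by nlinarith)
  have hθ0 := lineAngle_nonneg (r := r) (k := 1) hr zero_le_one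
  have hθ : lineAngle r 1 ≤ π / 6 := lineAngle_one_le_sixth (by linarith)
  have hφ : lineAngle r 2 ≤ π / 3 := lineAngle_le hr (by linarith) (by linarith) (by
    rw [sin_pi_div_three]; nlinarith)
  have hφ' : π / 3 - lineAngle r 1 ≤ lineAngle r 2 :=
    le_lineAngle hr (by linarith) (by linarith) (by
      rw [mul_sin_sub hr (by linarith)]
      nlinarith)
  have hT3 : truncInt (2 * r / √3) 3 (π / 3) (π / 3 + lineAngle r 1) = 0 := by
    refine truncInt_eq_zero (by linarith) fun φ hφ => ?_
    have e : sin φ ≤ sin (π / 3 + lineAngle r 1) :=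
      sin_le_sin_of_le_of_le_pi_div_two (by linarith [hφ.1]) (by linarith) hφ.2
    have e2 := mul_le_mul_of_nonneg_left e hr.le
    rw [mul_sin_add hr (by linarith)] at e2
    rw [div_mul_eq_mul_div, div_le_iff₀ (by positivity)]
    nlinarith
  rw [arcSum, truncInt_zero_arc (by linarith), truncInt_one_upper (by linarith),
    truncInt_one_lower (by linarith), hT3,
    truncInt_left (k := 2) hρ zero_le_two h1
    (by linarith) hφ' hφ (show _ ≤ π - lineAngle r 2 by linarith),
    truncInt_inside (k := 2) hρ zero_le_two h1 (by linarith) hφ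
      (show _ ≤ π - lineAngle r 2 by linarith),
    ← lineAngle, truncPrim_add 2 hr (by linarith), truncPrim_lineAngle hr zero_le_two (by linarith),
    truncPrim_third, sqrt_twelve]
  ring

/-- Levels 0, 1 and 2 are exceeded wherever they occur, so their truncations disappear. The level 3
term is kept, since its value differs on the two sides of r = 3. -/
theorem arcSum_of_sqrt_seven_le {r : ℝ} (h' : √7 ≤ r) :
    arcSum (2 * r / √3) (lineAngle r 1) =
      (2 * r ^ 2 / 3 + 9) * lineAngle r 1
        - √3 / 24 * (4 * r ^ 2 - 6 - 2 * √(4 * r ^ 2 - 3))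
        + √3 * (√(4 * r ^ 2 - 3) - 3) + √3 / 6 * r ^ 2 - 2 * √3 * r
      - truncInt (2 * r / √3) 3 (π / 3) (π / 3 + lineAngle r 1) := by
  have hp := pi_pos
  obtain ⟨h3, h31, h32⟩ := sqrt_three_facts
  obtain ⟨h7, h71, h72⟩ := sqrt_seven_facts
  have hr : 0 < r := by linarith
  have hρ : 0 < 2 * r / √3 := by positivity
  have h1 : 2 ≤ 2 * r / √3 := le_scale (by linarith)
  have h7 : 7 ≤ r ^ 2 := by nlinarith
  have hc : 5 ≤ √(4 * r ^ 2 - 3) := sqrt_ge (by linarith)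
  have hθ0 := lineAngle_nonneg (r := r) (k := 1) hr zero_le_one
  have hθ : lineAngle r 1 ≤ π / 6 := lineAngle_one_le_sixth (by linarith)
  have hφ' : lineAngle r 2 ≤ π / 3 - lineAngle r 1 :=
    lineAngle_le hr (by linarith) (by linarith) (by
      rw [mul_sin_sub hr (by linarith)]
      nlinarith)
  rw [arcSum, truncInt_zero_arc (by linarith), truncInt_one_upper (by linarith),
    truncInt_one_lower (by linarith),
    truncInt_inside (k := 2) hρ zero_le_two h1 (by linarith) hφ'
      (show _ ≤ π - lineAngle r 2 by linarith),
    truncInt_inside (k := 2) hρ zero_le_two h1 (by linarith)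
      (show lineAngle r 2 ≤ _ by linarith)
      (show _ ≤ π - lineAngle r 2 by linarith),
    truncPrim_add 2 hr (by linarith), truncPrim_sub 2 hr (by linarith), truncPrim_third]
  ring

theorem truncInt_three_upper {r : ℝ} (h' : √7 ≤ r) (h : r ≤ 3) :
    truncInt (2 * r / √3) 3 (π / 3) (π / 3 + lineAngle r 1) =
      (2 * r ^ 2 / 3 + 9) * (π / 3 + lineAngle r 1 - lineAngle r 3)
        - √3 / 24 * (4 * r ^ 2 - 6 - 2 * √(4 * r ^ 2 - 3))
        + √3 * (√(4 * r ^ 2 - 3) - 3) - 3 * √3 / 2 * √(4 * r ^ 2 - 27) := by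
  have hp := pi_pos
  obtain ⟨h3, h31, h32⟩ := sqrt_three_facts
  obtain ⟨h7, h71, h72⟩ := sqrt_seven_facts
  have hr : 0 < r := by linarith
  have hρ : 0 < 2 * r / √3 := by positivity
  have h1 : 3 ≤ 2 * r / √3 := le_scale (by linarith)
  have h7 : 7 ≤ r ^ 2 := by nlinarith
  have hc : 5 ≤ √(4 * r ^ 2 - 3) := sqrt_ge (by linarith)
  have hθ0 := lineAngle_nonneg (r := r) (k := 1) hr zero_le_one
  have hθ : lineAngle r 1 ≤ π / 6 := lineAngle_one_le_sixth (by linarith)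
  have hφ : π / 3 ≤ lineAngle r 3 := le_lineAngle hr (by linarith) (by linarith) (by
    rw [sin_pi_div_three]; nlinarith)
  have hφ' : lineAngle r 3 ≤ π / 3 + lineAngle r 1 :=
    lineAngle_le hr (by linarith) (by linarith) (by
      rw [mul_sin_add hr (by linarith)]
      nlinarith)
  have hφ2 := lineAngle_le_pi_div_two r 3
  rw [truncInt_left (k := 3) hρ zero_le_three h1
    (by linarith) hφ hφ' (show _ ≤ π - lineAngle r 3 by linarith), ← lineAngle,
    truncPrim_add 3 hr (by linarith), truncPrim_lineAngle hr zero_le_three (by linarith)]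
  norm_num
  ring

/-- Level 3 is also exceeded on the whole upper arc, and the untruncated squares cancel.
Geometrically, 3 is the largest distance between the rhombuses. -/
theorem arcSum_of_three_le {r : ℝ} (h : 3 ≤ r) :
    arcSum (2 * r / √3) (lineAngle r 1) = 0 := by
  have hp := pi_pos
  obtain ⟨h3, h31, h32⟩ := sqrt_three_facts
  obtain ⟨h7, h71, h72⟩ := sqrt_seven_facts
  have hr : 0 < r := by linarith
  have hρ : 0 < 2 * r / √3 := by positivity
  have h1 : 3 ≤ 2 * r / √3 := le_scale (by linarith)
  have hθ0 := lineAngle_nonneg (r := r) (k := 1) hr zero_le_one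
  have hθ : lineAngle r 1 ≤ π / 6 := lineAngle_one_le_sixth (by linarith)
  have hφ : lineAngle r 3 ≤ π / 3 := lineAngle_le hr (by linarith) (by linarith) (by
    rw [sin_pi_div_three]; nlinarith)
  rw [arcSum_of_sqrt_seven_le (by linarith), truncInt_inside (k := 3) hρ zero_le_three h1
    (by linarith) hφ (show _ ≤ π - lineAngle r 3 by linarith),
    truncPrim_add 3 hr (by linarith), truncPrim_third]
  ring

/-- The factor 2 r √3 / 3 is the polar Jacobian r times the factor 2/√3 from u = (2/√3) y. -/
theorem densityDI_eq {r : ℝ} (hr : 0 < r) :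
    densityDI r = 2 * r * (arcSum (2 * r / √3) (maxAngle r) * √3 / 3) := by
  obtain ⟨h3, h31, h32⟩ := sqrt_three_facts
  obtain ⟨h7, h71, h72⟩ := sqrt_seven_facts
  have hi : (√3)⁻¹ = √3 / 3 := by
    rw [inv_eq_iff_eq_inv, inv_div, eq_div_iff (by positivity), h3]
  rw [densityDI, if_neg hr.not_gt, arcsin_eq_lineAngle_one, arcsin_eq_lineAngle_two,
    arcsin_eq_lineAngle_three, maxAngle, arcsin_eq_lineAngle_one]
  set c := √(4 * r ^ 2 - 3) with hc
  set e := √(r ^ 2 - 3) with he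
  set θ₁ := lineAngle r 1 with hθ₁
  set θ₂ := lineAngle r 2 with hθ₂
  rcases le_or_gt r (√3 / 2) with g₁ | g₁
  · rw [if_pos g₁, if_pos (by linarith), arcSum_of_le_half hr (by linarith)]
    simp only [div_eq_mul_inv, mul_inv, hi]
    -- After 1/√3 is replaced by √3/3, the two sides differ only by √3 · √3 = 3 in the terms without
    -- π or an angle. In each branch the coefficient is -2r/3 times those terms.
    linear_combination 2 * r / 3 * (1 / 6 * r ^ 2) * h3
  rw [if_neg g₁.not_ge]
  rcases le_or_gt r 1 with g₂ | g₂
  · rw [if_pos g₂, if_pos g₂, arcSum_of_le_one (by linarith) g₂, ← hc, ← hθ₁]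
    simp only [div_eq_mul_inv, mul_inv, hi]
    linear_combination 2 * r / 3 * (1 / 6 * r ^ 2 - c) * h3
  rw [if_neg g₂.not_ge, if_neg g₂.not_ge]
  rcases le_or_gt r √3 with g₃ | g₃
  · rw [if_pos g₃, hθ₁, arcSum_of_le_sqrt_three g₂.le g₃, ← hc, ← hθ₁]
    simp only [div_eq_mul_inv, mul_inv, hi]
    linear_combination -(2 * r / 3) * (1 / 3 * r ^ 2 + 2 / 3 * c - 2 / 3 * r + 1 / 2) * h3
  rw [if_neg g₃.not_ge]
  rcases le_or_gt r 2 with g₄ | g₄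
  · rw [if_pos g₄, hθ₁, arcSum_of_le_two g₃.le g₄, ← hc, ← hθ₁, ← hθ₂, ← he]
    simp only [div_eq_mul_inv, mul_inv, hi]
    linear_combination -(2 * r / 3) * (-1 / 3 * r ^ 2 + 5 / 3 * c - 4 * e - 2 / 3 * r - 1 / 2) * h3
  rw [if_neg g₄.not_ge]
  rcases le_or_gt r √7 with g₅ | g₅
  · rw [if_pos g₅, hθ₁, arcSum_of_le_sqrt_seven g₄.le g₅, ← hc, ← hθ₁, ← hθ₂, ← he]
    simp only [div_eq_mul_inv, mul_inv, hi]
    linear_combination -(2 * r / 3) * (-1 / 6 * r ^ 2 + 5 / 3 * c - 2 * e - 2 * r - 1 / 2) * h3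
  rw [if_neg g₅.not_ge]
  rcases le_or_gt r 3 with g₆ | g₆
  · rw [if_pos g₆, hθ₁, arcSum_of_sqrt_seven_le g₅.le, truncInt_three_upper g₅.le g₆, ← hc, ← hθ₁]
    simp only [div_eq_mul_inv, mul_inv, hi]
    linear_combination -(2 * r / 3) * (1 / 6 * r ^ 2 + 3 / 2 * √(4 * r ^ 2 - 27) - 2 * r) * h3
  · rw [if_neg g₆.not_ge, hθ₁, arcSum_of_three_le g₆.le]
    ring

/-! ### The density of the difference vector -/

/-- The density of a difference of two independent uniform variables on `[0, 1]`. -/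
def tent (w : ℝ) : ℝ := max (1 - |w|) 0

/-- The joint density of the difference vector of random points of the two rhombuses, in
coordinates for which its squared length is `x ^ 2 + 3 / 4 * u ^ 2`. -/
def diffDensity (x u : ℝ) : ℝ :=
  if |u| ≤ 1 then
    ((max (x - |u| / 2) 0) ^ 2 - 2 * (max (x - |u| / 2 - 1) 0) ^ 2 + (max (x - |u| / 2 - 2) 0) ^ 2
      - (max (x + |u| / 2 - 1) 0) ^ 2 + 2 * (max (x + |u| / 2 - 2) 0) ^ 2
      - (max (x + |u| / 2 - 3) 0) ^ 2) / 2
  else 0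

theorem continuous_tent : Continuous tent := by unfold tent; fun_prop

theorem tent_nonneg (w : ℝ) : 0 ≤ tent w := le_max_right _ _

theorem hasDerivAt_max_sq (t : ℝ) : HasDerivAt (fun t : ℝ => (max t 0) ^ 2) (2 * max t 0) t := by
  rcases lt_trichotomy t 0 with h | rfl | h
  · rw [max_eq_right h.le, mul_zero]
    refine (hasDerivAt_const t (0 : ℝ)).congr_of_eventuallyEq ?_
    filter_upwards [gt_mem_nhds h] with s hs
    rw [max_eq_right hs.le]; norm_num
  · rw [max_self, mul_zero, hasDerivAt_iff_isLittleO]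
    simp only [max_self, sub_zero, smul_zero]
    rw [Asymptotics.isLittleO_iff]
    intro c hc
    filter_upwards [Metric.ball_mem_nhds (0 : ℝ) hc] with s hs
    rw [mem_ball_zero_iff, norm_eq_abs] at hs
    have h1 : |max s 0| ≤ |s| := by
      rcases le_total s 0 with h | h
      · rw [max_eq_right h, abs_zero]; positivity
      · rw [max_eq_left h]
    rw [norm_eq_abs, norm_eq_abs]
    norm_num
    rw [← sq_abs (max s 0)]
    nlinarith [abs_nonneg (max s 0), abs_nonneg s]
  · rw [max_eq_left h.le]
    refine ((hasDerivAt_pow 2 t).congr_deriv (by norm_num)).congr_of_eventuallyEq ?_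
    filter_upwards [lt_mem_nhds h] with s hs
    rw [max_eq_left hs.le]

/-- An antiderivative of `tent`. -/
def tentPrim (t : ℝ) : ℝ := ((max (t + 1) 0) ^ 2 - 2 * (max t 0) ^ 2 + (max (t - 1) 0) ^ 2) / 2

/-- Writing the tent as a second difference of positive parts makes its antiderivative a second
difference of truncated squares. -/
theorem tent_eq (t : ℝ) : tent t = max (t + 1) 0 - 2 * max t 0 + max (t - 1) 0 := by
  unfold tent
  rcases abs_cases t with ⟨h1, h2⟩ | ⟨h1, h2⟩ <;>
  rcases max_cases (1 - |t|) 0 with ⟨h3, h4⟩ | ⟨h3, h4⟩ <;>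
  rcases max_cases (t + 1) 0 with ⟨h5, h6⟩ | ⟨h5, h6⟩ <;>
  rcases max_cases t 0 with ⟨h7, h8⟩ | ⟨h7, h8⟩ <;>
  rcases max_cases (t - 1) 0 with ⟨h9, h10⟩ | ⟨h9, h10⟩ <;>
  linarith

theorem hasDerivAt_tentPrim (t : ℝ) : HasDerivAt tentPrim (tent t) t := by
  have h1 := (hasDerivAt_max_sq (t + 1)).comp_add_const t 1
  have h2 := (hasDerivAt_max_sq t).const_mul 2
  have h3 := (hasDerivAt_max_sq (t - 1)).comp_sub_const t 1
  refine (((h1.sub h2).add h3).div_const 2).congr_deriv ?_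
  rw [tent_eq]
  ring

theorem integral_tent_sub (c α β : ℝ) :
    ∫ m in α..β, tent (c - m) = tentPrim (c - α) - tentPrim (c - β) := by
  rw [intervalIntegral.integral_comp_sub_left]
  exact intervalIntegral.integral_eq_sub_of_hasDerivAt (fun t _ => hasDerivAt_tentPrim t)
    (continuous_tent.intervalIntegrable _ _)

/-- `tentPrim` is evaluated at x - 1 - |u|/2 and x - 2 + |u|/2, and each value contributes three of
the six squares. Nonnegativity follows from this form. -/
theorem diffDensity_eq_integral {x u : ℝ} (hu : |u| ≤ 1) :
    diffDensity x u = ∫ m in (|u| / 2)..(1 - |u| / 2), tent (x - 1 - m) := by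
  rw [integral_tent_sub, diffDensity, if_pos hu, tentPrim, tentPrim]
  ring_nf

theorem diffDensity_nonneg (x u : ℝ) : 0 ≤ diffDensity x u := by
  by_cases hu : |u| ≤ 1
  · rw [diffDensity_eq_integral hu]
    exact intervalIntegral.integral_nonneg (by linarith) fun m _ => tent_nonneg _
  · rw [diffDensity, if_neg hu]

theorem lintegral_tent (x u : ℝ) :
    ∫⁻ m in Set.Icc (|u| / 2) (1 - |u| / 2), ENNReal.ofReal (tent (x - 1 - m)) =
      ENNReal.ofReal (diffDensity x u) := by
  by_cases hu : |u| ≤ 1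
  · rw [diffDensity_eq_integral hu, intervalIntegral.integral_of_le (by linarith),
      ← integral_Icc_eq_integral_Ioc, ofReal_integral_eq_lintegral_ofReal]
    · refine Continuous.integrableOn_Icc ?_
      exact continuous_tent.comp (by fun_prop)
    · exact Filter.Eventually.of_forall fun m => tent_nonneg _
  -- For |u| > 1 the interval of integration is empty, which matches the cutoff in `diffDensity`.
  · rw [diffDensity, if_neg hu, Set.Icc_eq_empty (by linarith)]
    simp

theorem diffDensity_eq_zero {x u : ℝ} (h : x ≤ |u| / 2) : diffDensity x u = 0 := by
  unfold diffDensity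
  split_ifs with hu
  · rw [max_eq_right (by linarith), max_eq_right (by linarith), max_eq_right (by linarith),
      max_eq_right (by linarith), max_eq_right (by linarith), max_eq_right (by linarith)]
    norm_num
  · rfl

theorem measurable_diffDensity : Measurable fun p : ℝ × ℝ => diffDensity p.1 p.2 := by
  unfold diffDensity
  refine Measurable.ite ?_ (Continuous.measurable (by fun_prop)) measurable_const
  exact measurableSet_le (by fun_prop) (by fun_prop)

/-! ### Integration over circles -/

theorem maxAngle_nonneg {r : ℝ} (hr : 0 < r) : 0 ≤ maxAngle r := by
  unfold maxAngle
  split_ifs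
  · positivity
  · exact arcsin_nonneg.2 (by positivity)

theorem maxAngle_le {r : ℝ} : maxAngle r ≤ π / 3 := by
  unfold maxAngle
  split_ifs with h
  · rfl
  · rw [arcsin_eq_lineAngle_one]
    exact lineAngle_one_le (not_le.1 h).le

theorem mul_sin_le_of_le_maxAngle {r θ : ℝ} (hr : 0 < r) (h0 : 0 ≤ θ) (h : θ ≤ maxAngle r) :
    r * sin θ ≤ √3 / 2 := by
  have hp := pi_pos
  have h2 := maxAngle_le (r := r)
  have h1 : sin θ ≤ sin (maxAngle r) :=
    sin_le_sin_of_le_of_le_pi_div_two (by linarith) (by linarith) h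
  unfold maxAngle at h1
  split_ifs at h1 with hr1
  · rw [sin_pi_div_three] at h1
    nlinarith [sqrt_nonneg 3]
  · have h3 := sqrt_three_facts
    have h4 := mul_sin_lineAngle hr zero_le_one (by linarith)
    rw [arcsin_eq_lineAngle_one] at h1
    nlinarith

theorem diffDensity_polar {r θ : ℝ} (hr : 0 < r) (h0 : 0 ≤ θ) (h : θ ≤ maxAngle r) :
    diffDensity (r * cos θ) (2 / √3 * (r * sin θ)) =
      ((max (2 * r / √3 * sin (π / 3 - θ) - 0) 0) ^ 2
        - 2 * (max (2 * r / √3 * sin (π / 3 - θ) - 1) 0) ^ 2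
        + (max (2 * r / √3 * sin (π / 3 - θ) - 2) 0) ^ 2
        - (max (2 * r / √3 * sin (π / 3 + θ) - 1) 0) ^ 2
        + 2 * (max (2 * r / √3 * sin (π / 3 + θ) - 2) 0) ^ 2
        - (max (2 * r / √3 * sin (π / 3 + θ) - 3) 0) ^ 2) / 2 := by
  have hp := pi_pos
  have h2 := maxAngle_le (r := r)
  have h3 : 0 < √3 := by positivity
  have hs : 0 ≤ sin θ := sin_nonneg_of_nonneg_of_le_pi h0 (by linarith)
  have hu : |2 / √3 * (r * sin θ)| = 2 / √3 * (r * sin θ) := abs_of_nonneg (by positivity)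
  have e1 : 2 * r / √3 * sin (π / 3 - θ) = r * cos θ - 2 / √3 * (r * sin θ) / 2 := by
    rw [sin_sub, sin_pi_div_three, cos_pi_div_three]
    field_simp
  have e2 : 2 * r / √3 * sin (π / 3 + θ) = r * cos θ + 2 / √3 * (r * sin θ) / 2 := by
    rw [sin_add, sin_pi_div_three, cos_pi_div_three]
    field_simp
  rw [diffDensity, if_pos, hu, e1, e2, sub_zero]
  rw [hu, div_mul_eq_mul_div, div_le_one h3]
  linarith [mul_sin_le_of_le_maxAngle hr h0 h]

/-- There are two ways to leave the support: θ ≥ π/3 forces x ≤ |u|/2, while an angle between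
`lineAngle r 1` and π/3 forces |u| > 1. -/
theorem diffDensity_polar_eq_zero {r θ : ℝ} (hr : 0 < r) (h0 : maxAngle r < θ) (h : θ ≤ π) :
    diffDensity (r * cos θ) (2 / √3 * (r * sin θ)) = 0 := by
  have hp := pi_pos
  have h3 : 0 < √3 := by positivity
  have hm := maxAngle_nonneg hr
  by_cases hθ : π / 3 ≤ θ
  · refine diffDensity_eq_zero (le_trans ?_
      (div_le_div_of_nonneg_right (le_abs_self _) zero_le_two))
    have h4 : 0 ≤ sin (θ - π / 3) := sin_nonneg_of_nonneg_of_le_pi (by linarith) (by linarith)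
    rw [sin_sub, sin_pi_div_three, cos_pi_div_three] at h4
    rw [div_mul_eq_mul_div, div_div, le_div_iff₀ (by positivity)]
    nlinarith
  · have h1 : 1 < r := by
      by_contra h1
      rw [maxAngle, if_pos (not_lt.1 h1)] at h0
      linarith
    rw [maxAngle, if_neg h1.not_ge, arcsin_eq_lineAngle_one] at h0
    rw [diffDensity, if_neg]
    rw [not_le]
    refine lt_of_lt_of_le ?_ (le_abs_self _)
    rw [div_mul_eq_mul_div, one_lt_div h3]
    have h5 := sqrt_three_facts
    have h4 := mul_sin_lineAngle hr zero_le_one (by linarith)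
    have h6 : sin (lineAngle r 1) < sin θ :=
      sin_lt_sin_of_lt_of_le_pi_div_two (by linarith [lineAngle_nonneg hr zero_le_one])
        (by linarith) h0
    nlinarith

theorem diffDensity_neg (x u : ℝ) : diffDensity x (-u) = diffDensity x u := by
  rw [diffDensity, diffDensity, abs_neg]

theorem diffDensity_polar_abs (r θ : ℝ) :
    diffDensity (r * cos |θ|) (2 / √3 * (r * sin |θ|)) =
      diffDensity (r * cos θ) (2 / √3 * (r * sin θ)) := by
  rcases abs_choice θ with h | h
  · rw [h]
  · rw [h, cos_neg, sin_neg, mul_neg, mul_neg, diffDensity_neg]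

theorem continuousOn_diffDensity_polar {r : ℝ} (hr : 0 < r) :
    ContinuousOn (fun θ => diffDensity (r * cos θ) (2 / √3 * (r * sin θ)))
      (Set.Icc (-maxAngle r) (maxAngle r)) := by
  refine ContinuousOn.congr (f := fun θ => _) ?_ fun θ hθ =>
    (diffDensity_polar_abs r θ).symm.trans
      (diffDensity_polar hr (abs_nonneg θ) (abs_le.2 hθ))
  fun_prop

/-- Evenness in θ doubles the integral over [0, `maxAngle r`], which cancels the 1/2 in
`diffDensity`. The substitutions φ = π/3 ∓ θ produce the two arcs. -/
theorem integral_diffDensity_polar {r : ℝ} (hr : 0 < r) :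
    ∫ θ in (-maxAngle r)..(maxAngle r), diffDensity (r * cos θ) (2 / √3 * (r * sin θ)) =
      arcSum (2 * r / √3) (maxAngle r) := by
  have hm := maxAngle_nonneg hr
  have hc := continuousOn_diffDensity_polar hr
  have hi1 : IntervalIntegrable (fun θ => diffDensity (r * cos θ) (2 / √3 * (r * sin θ)))
      volume 0 (maxAngle r) :=
    (hc.mono (Set.Icc_subset_Icc_left (by linarith))).intervalIntegrable_of_Icc hm
  have hi2 : IntervalIntegrable (fun θ => diffDensity (r * cos θ) (2 / √3 * (r * sin θ)))
      volume (-maxAngle r) 0 :=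
    (hc.mono (Set.Icc_subset_Icc_right (by linarith))).intervalIntegrable_of_Icc (by linarith)
  have hneg : ∫ θ in (-maxAngle r)..0, diffDensity (r * cos θ) (2 / √3 * (r * sin θ)) =
      ∫ θ in 0..(maxAngle r), diffDensity (r * cos θ) (2 / √3 * (r * sin θ)) := by
    rw [← neg_zero, ← intervalIntegral.integral_comp_neg, neg_zero]
    simp only [cos_neg, sin_neg, mul_neg, diffDensity_neg]
  have hsub : ∀ k : ℝ, truncInt (2 * r / √3) k (π / 3 - maxAngle r) (π / 3) =
      ∫ θ in 0..(maxAngle r), (max (2 * r / √3 * sin (π / 3 - θ) - k) 0) ^ 2 := fun k => by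
    rw [intervalIntegral.integral_comp_sub_left
      (fun φ => (max (2 * r / √3 * sin φ - k) 0) ^ 2), sub_zero, truncInt]
  have hadd : ∀ k : ℝ, truncInt (2 * r / √3) k (π / 3) (π / 3 + maxAngle r) =
      ∫ θ in 0..(maxAngle r), (max (2 * r / √3 * sin (π / 3 + θ) - k) 0) ^ 2 := fun k => by
    rw [intervalIntegral.integral_comp_add_left
      (fun φ => (max (2 * r / √3 * sin φ - k) 0) ^ 2), add_zero, truncInt]
  have hpos : ∫ θ in 0..(maxAngle r), diffDensity (r * cos θ) (2 / √3 * (r * sin θ)) =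
      ∫ θ in 0..(maxAngle r), ((max (2 * r / √3 * sin (π / 3 - θ) - 0) 0) ^ 2
        - 2 * (max (2 * r / √3 * sin (π / 3 - θ) - 1) 0) ^ 2
        + (max (2 * r / √3 * sin (π / 3 - θ) - 2) 0) ^ 2
        - (max (2 * r / √3 * sin (π / 3 + θ) - 1) 0) ^ 2
        + 2 * (max (2 * r / √3 * sin (π / 3 + θ) - 2) 0) ^ 2
        - (max (2 * r / √3 * sin (π / 3 + θ) - 3) 0) ^ 2) / 2 := by
    refine intervalIntegral.integral_congr fun θ hθ => ?_
    rw [Set.uIcc_of_le hm] at hθ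
    exact diffDensity_polar hr hθ.1 hθ.2
  have hI : ∀ f : ℝ → ℝ, Continuous f → IntervalIntegrable f volume 0 (maxAngle r) :=
    fun f hf => hf.intervalIntegrable _ _
  rw [← intervalIntegral.integral_add_adjacent_intervals hi2 hi1, hneg, hpos, arcSum, hsub, hsub,
    hsub, hadd, hadd, hadd, intervalIntegral.integral_div,
    intervalIntegral.integral_sub (hI _ (by fun_prop)) (hI _ (by fun_prop)),
    intervalIntegral.integral_add (hI _ (by fun_prop)) (hI _ (by fun_prop)),
    intervalIntegral.integral_sub (hI _ (by fun_prop)) (hI _ (by fun_prop)),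
    intervalIntegral.integral_add (hI _ (by fun_prop)) (hI _ (by fun_prop)),
    intervalIntegral.integral_sub (hI _ (by fun_prop)) (hI _ (by fun_prop)),
    intervalIntegral.integral_const_mul, intervalIntegral.integral_const_mul]
  ring

theorem arcSum_nonneg {r : ℝ} (hr : 0 < r) : 0 ≤ arcSum (2 * r / √3) (maxAngle r) := by
  rw [← integral_diffDensity_polar hr]
  exact intervalIntegral.integral_nonneg (by linarith [maxAngle_nonneg hr])
    fun θ _ => diffDensity_nonneg _ _

theorem densityDI_of_nonpos {d : ℝ} (h : d ≤ 0) : densityDI d = 0 := by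
  rcases h.lt_or_eq with h | rfl
  · rw [densityDI, if_pos h, mul_zero]
  · simp [densityDI]

theorem densityDI_nonneg (d : ℝ) : 0 ≤ densityDI d := by
  rcases le_or_gt d 0 with h | h
  · rw [densityDI_of_nonpos h]
  · rw [densityDI_eq h]
    have := arcSum_nonneg h
    positivity

theorem lintegral_diffDensity_polar {r : ℝ} (hr : 0 < r) :
    ∫⁻ θ in Set.Ioo (-π) π, ENNReal.ofReal (diffDensity (r * cos θ) (2 / √3 * (r * sin θ))) =
      ENNReal.ofReal (arcSum (2 * r / √3) (maxAngle r)) := by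
  have hp := pi_pos
  have hm := maxAngle_nonneg hr
  have hm' := maxAngle_le (r := r)
  rw [← integral_diffDensity_polar hr, intervalIntegral.integral_of_le (by linarith),
      ← integral_Icc_eq_integral_Ioc, ofReal_integral_eq_lintegral_ofReal
      (continuousOn_diffDensity_polar hr).integrableOn_Icc
      (Filter.Eventually.of_forall fun θ => diffDensity_nonneg _ _)]
  symm
  rw [← lintegral_indicator measurableSet_Icc, ← lintegral_indicator measurableSet_Ioo]
  refine lintegral_congr fun θ => ?_
  by_cases h1 : θ ∈ Set.Icc (-maxAngle r) (maxAngle r)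
  · have h2 : θ ∈ Set.Ioo (-π) π := ⟨by linarith [h1.1], by linarith [h1.2]⟩
    rw [Set.indicator_of_mem h1, Set.indicator_of_mem h2]
  · rw [Set.indicator_of_notMem h1, Set.indicator_apply]
    split_ifs with h2
    · rw [← diffDensity_polar_abs, diffDensity_polar_eq_zero hr _
        (abs_le.2 ⟨h2.1.le, h2.2.le⟩), ENNReal.ofReal_zero]
      by_contra h
      exact h1 (abs_le.1 (not_lt.1 h))
    · rfl

theorem lintegral_comp_mul_left {a : ℝ} (ha : 0 < a) {f : ℝ → ENNReal} (hf : Measurable f) :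
    ∫⁻ u, f u = ENNReal.ofReal a * ∫⁻ y, f (a * y) := by
  conv_lhs => rw [← Real.smul_map_volume_mul_left ha.ne']
  rw [lintegral_smul_measure, lintegral_map hf (by fun_prop), abs_of_pos ha, smul_eq_mul]

/-- The substitution u = (2/√3) y turns x² + 3u²/4 into x² + y², and polar coordinates then separate
g from the angular integral. -/
theorem lintegral_diffDensity_mul {g : ℝ → ENNReal} (hg : Measurable g) :
    ∫⁻ u, ∫⁻ x, ENNReal.ofReal (diffDensity x u) * g √(x ^ 2 + 3 / 4 * u ^ 2) =
      ∫⁻ r, ENNReal.ofReal (densityDI r) * g r := by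
  have h3 : 0 < 2 / √3 := by positivity
  have hD := measurable_diffDensity
  have hF : Measurable fun p : ℝ × ℝ =>
      ENNReal.ofReal (diffDensity p.1 p.2) * g √(p.1 ^ 2 + 3 / 4 * p.2 ^ 2) :=
    hD.ennreal_ofReal.mul (hg.comp (by fun_prop))
  have hF' : Measurable fun p : ℝ × ℝ =>
      ENNReal.ofReal (diffDensity p.1 (2 / √3 * p.2)) * g √(p.1 ^ 2 + p.2 ^ 2) :=
    (hD.comp (measurable_fst.prodMk (measurable_snd.const_mul _))).ennreal_ofReal.mul
      (hg.comp (by fun_prop))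
  have hs : (2 / √3) ^ 2 = 4 / 3 := by rw [div_pow, sq_sqrt (by norm_num)]; norm_num
  rw [lintegral_comp_mul_left h3 (f := fun u => ∫⁻ x, ENNReal.ofReal (diffDensity x u) *
    g √(x ^ 2 + 3 / 4 * u ^ 2)) hF.lintegral_prod_left']
  simp only [mul_pow, hs, ← mul_assoc]
  norm_num only [one_mul]
  rw [← lintegral_prod_symm' _ hF', ← Measure.volume_eq_prod, ← lintegral_comp_polarCoord_symm]
  simp only [polarCoord_symm_apply, smul_eq_mul]
  rw [polarCoord_target, Measure.volume_eq_prod, ← Measure.prod_restrict, lintegral_prod]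
  · rw [← lintegral_const_mul', ← lintegral_indicator measurableSet_Ioi]
    · refine lintegral_congr fun r => ?_
      rw [Set.indicator_apply]
      split_ifs with hr
      · have hr : 0 < r := hr
        have e : ∀ θ, √((r * cos θ) ^ 2 + (r * sin θ) ^ 2) = r := fun θ => by
          rw [show (r * cos θ) ^ 2 + (r * sin θ) ^ 2 = r ^ 2 by
            linear_combination r ^ 2 * sin_sq_add_cos_sq θ, sqrt_sq hr.le]
        have hm : Measurable fun θ : ℝ =>
            ENNReal.ofReal (diffDensity (r * cos θ) (2 / √3 * (r * sin θ))) :=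
          (hD.comp (f := fun θ : ℝ => (r * cos θ, 2 / √3 * (r * sin θ)))
            (by fun_prop)).ennreal_ofReal
        simp only [e]
        rw [lintegral_const_mul' _ _ ENNReal.ofReal_ne_top, lintegral_mul_const _ hm,
          lintegral_diffDensity_polar hr, ← mul_assoc, ← mul_assoc,
          ← ENNReal.ofReal_mul h3.le, ← ENNReal.ofReal_mul (by positivity), densityDI_eq hr]
        congr 2
        have h3 : √3 * √3 = 3 := mul_self_sqrt (by norm_num)
        field_simp
        linear_combination (-arcSum (2 * r / √3) (maxAngle r)) * h3
      · rw [densityDI_of_nonpos (not_lt.1 hr), ENNReal.ofReal_zero, zero_mul]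
    · exact ENNReal.ofReal_ne_top
  · refine Measurable.aemeasurable ?_
    exact (measurable_fst.ennreal_ofReal).mul (hF'.comp
      (f := fun p : ℝ × ℝ => (p.1 * cos p.2, p.1 * sin p.2)) (by fun_prop))

/-! ### From coordinates in the rhombuses to the difference vector -/

/-- For fixed w = s - t, the admissible s form the overlap of [0, 1] with its translate by w, which
has length `tent w`. -/
theorem lintegral_lintegral_sub {f : ℝ → ENNReal} (hf : Measurable f) :
    ∫⁻ s in Set.Icc (0 : ℝ) 1, ∫⁻ t in Set.Icc (0 : ℝ) 1, f (s - t) =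
      ∫⁻ w, ENNReal.ofReal (tent w) * f w := by
  set I : ℝ → ENNReal := (Set.Icc (0 : ℝ) 1).indicator 1 with hI
  have hIm : Measurable I := measurable_one.indicator measurableSet_Icc
  have h1 : ∀ F : ℝ → ENNReal, ∫⁻ s in Set.Icc (0 : ℝ) 1, F s = ∫⁻ s, I s * F s := fun F => by
    rw [← lintegral_indicator measurableSet_Icc]
    refine lintegral_congr fun s => ?_
    simp only [hI, Set.indicator_apply]
    split_ifs <;> simp
  calc ∫⁻ s in Set.Icc (0 : ℝ) 1, ∫⁻ t in Set.Icc (0 : ℝ) 1, f (s - t)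
      = ∫⁻ s, ∫⁻ t, I s * (I t * f (s - t)) := by
        rw [h1]
        refine lintegral_congr fun s => ?_
        rw [h1, lintegral_const_mul]
        fun_prop
    _ = ∫⁻ s, ∫⁻ w, I s * (I (s - w) * f w) := by
        refine lintegral_congr fun s => ?_
        rw [← lintegral_sub_left_eq_self _ s]
        simp only [sub_sub_cancel]
    _ = ∫⁻ w, ∫⁻ s, I s * (I (s - w) * f w) := lintegral_lintegral_swap (by fun_prop)
    _ = ∫⁻ w, ENNReal.ofReal (tent w) * f w := by
        refine lintegral_congr fun w => ?_
        simp only [← mul_assoc]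
        rw [lintegral_mul_const _ (by fun_prop)]
        congr 1
        have : (fun s => I s * I (s - w)) = (Set.Icc (max 0 w) (min 1 (1 + w))).indicator 1 := by
          ext s
          simp only [hI, Set.indicator_apply, Set.mem_Icc, max_le_iff, le_min_iff]
          split_ifs with a b c c b c c <;> simp <;> grind
        rw [this, lintegral_indicator_one measurableSet_Icc, Real.volume_Icc]
        unfold tent
        rcases abs_cases w with ⟨h1, h2⟩ | ⟨h1, h2⟩
        · rw [h1, max_eq_right h2, min_eq_left (by linarith), ENNReal.ofReal_max]; simp
        · rw [h1, max_eq_left h2.le, min_eq_right (by linarith), ENNReal.ofReal_max]; simp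

/-- The map to (m, u) has determinant ±1 and carries the unit square onto |u|/2 ≤ m ≤ 1 - |u|/2. It
is carried out as two one-variable translations or reflections with Tonelli in between. -/
theorem lintegral_lintegral_half {H : ℝ × ℝ → ENNReal} (hH : Measurable H) :
    ∫⁻ t in Set.Icc (0 : ℝ) 1, ∫⁻ s in Set.Icc (0 : ℝ) 1, H ((1 - t + s) / 2, s - 1 + t) =
      ∫⁻ u, ∫⁻ m in Set.Icc (|u| / 2) (1 - |u| / 2), H (m, u) := by
  set I : ℝ → ENNReal := (Set.Icc (0 : ℝ) 1).indicator 1 with hI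
  have hIm : Measurable I := measurable_one.indicator measurableSet_Icc
  have h1 : ∀ F : ℝ → ENNReal, ∫⁻ s in Set.Icc (0 : ℝ) 1, F s = ∫⁻ s, I s * F s := fun F => by
    rw [← lintegral_indicator measurableSet_Icc]
    refine lintegral_congr fun s => ?_
    simp only [hI, Set.indicator_apply]
    split_ifs <;> simp
  calc ∫⁻ t in Set.Icc (0 : ℝ) 1, ∫⁻ s in Set.Icc (0 : ℝ) 1, H ((1 - t + s) / 2, s - 1 + t)
      = ∫⁻ t, ∫⁻ s, I t * (I s * H ((1 - t + s) / 2, s - 1 + t)) := by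
        rw [h1]
        refine lintegral_congr fun s => ?_
        rw [h1, lintegral_const_mul]
        fun_prop
    _ = ∫⁻ t, ∫⁻ u, I t * (I (u + (1 - t)) * H (1 - t + u / 2, u)) := by
        refine lintegral_congr fun t => ?_
        rw [← lintegral_add_right_eq_self _ (1 - t)]
        refine lintegral_congr fun u => ?_
        ring_nf
    _ = ∫⁻ u, ∫⁻ t, I t * (I (u + (1 - t)) * H (1 - t + u / 2, u)) :=
        lintegral_lintegral_swap (by fun_prop)
    _ = ∫⁻ u, ∫⁻ m in Set.Icc (|u| / 2) (1 - |u| / 2), H (m, u) := by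
        refine lintegral_congr fun u => ?_
        rw [← lintegral_sub_left_eq_self _ (1 + u / 2), ← lintegral_indicator measurableSet_Icc]
        refine lintegral_congr fun m => ?_
        rw [show 1 - (1 + u / 2 - m) + u / 2 = m by ring,
          show u + (1 - (1 + u / 2 - m)) = m + u / 2 by ring]
        simp only [hI, Set.indicator_apply, Set.mem_Icc]
        split_ifs with a b c c b c c <;> simp <;> grind

/-- The law of the distance of random points of the two rhombuses, as an integral over the
coordinates of the points. -/
theorem lintegral_coordinates {g : ℝ → ENNReal} (hg : Measurable g) :
    ∫⁻ t in Set.Icc (0 : ℝ) 1, ∫⁻ a in Set.Icc (0 : ℝ) 1,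
      ∫⁻ s in Set.Icc (0 : ℝ) 1, ∫⁻ b in Set.Icc (0 : ℝ) 1,
        g √((1 + (1 - t + a) / 2 + (s - b)) ^ 2 + 3 / 4 * (a - 1 + t) ^ 2) =
      ∫⁻ r, ENNReal.ofReal (densityDI r) * g r := by
  have hc := continuous_tent.measurable
  have hD := measurable_diffDensity
  calc _ = ∫⁻ t in Set.Icc (0 : ℝ) 1, ∫⁻ a in Set.Icc (0 : ℝ) 1,
      (fun p : ℝ × ℝ => ∫⁻ w, ENNReal.ofReal (tent w) *
        g √((1 + p.1 + w) ^ 2 + 3 / 4 * p.2 ^ 2)) ((1 - t + a) / 2, a - 1 + t) := by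
        refine lintegral_congr fun t => lintegral_congr fun a => ?_
        exact lintegral_lintegral_sub
          (f := fun w => g √((1 + (1 - t + a) / 2 + w) ^ 2 + 3 / 4 * (a - 1 + t) ^ 2))
          (by fun_prop)
    _ = ∫⁻ u, ∫⁻ m in Set.Icc (|u| / 2) (1 - |u| / 2), ∫⁻ w, ENNReal.ofReal (tent w) *
        g √((1 + m + w) ^ 2 + 3 / 4 * u ^ 2) :=
        lintegral_lintegral_half (Measurable.lintegral_prod_right' (f := fun p : (ℝ × ℝ) × ℝ =>
          ENNReal.ofReal (tent p.2) * g √((1 + p.1.1 + p.2) ^ 2 + 3 / 4 * p.1.2 ^ 2))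
          (by fun_prop))
    _ = ∫⁻ u, ∫⁻ m in Set.Icc (|u| / 2) (1 - |u| / 2), ∫⁻ x,
        ENNReal.ofReal (tent (x - 1 - m)) * g √(x ^ 2 + 3 / 4 * u ^ 2) := by
        refine lintegral_congr fun u => lintegral_congr fun m => ?_
        rw [← lintegral_sub_right_eq_self _ (1 + m)]
        refine lintegral_congr fun x => ?_
        ring_nf
    _ = ∫⁻ u, ∫⁻ x, ENNReal.ofReal (diffDensity x u) * g √(x ^ 2 + 3 / 4 * u ^ 2) := by
        refine lintegral_congr fun u => ?_
        rw [lintegral_lintegral_swap (by fun_prop)]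
        refine lintegral_congr fun x => ?_
        rw [lintegral_mul_const _ (by fun_prop), lintegral_tent]
    _ = _ := lintegral_diffDensity_mul hg

/-! ### Uniform distributions on rhombuses -/

/-- Affine isomorphisms carry uniform distributions to uniform distributions. -/
theorem cond_image_affine {E F : Type*} [NormedAddCommGroup E] [NormedSpace ℝ E]
    [FiniteDimensional ℝ E] [MeasurableSpace E] [BorelSpace E] [NormedAddCommGroup F]
    [NormedSpace ℝ F] [FiniteDimensional ℝ F] [MeasurableSpace F] [BorelSpace F]
    (μ : Measure E) [μ.IsAddHaarMeasure] (ν : Measure F) [ν.IsAddHaarMeasure]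
    (L : E ≃L[ℝ] F) (c : F) {s : Set E} (hs : MeasurableSet s) :
    ProbabilityTheory.cond ν ((fun x => c + L x) '' s) =
      (ProbabilityTheory.cond μ s).map (fun x => c + L x) := by
  set A : E ≃ₜ F := L.toHomeomorph.trans (Homeomorph.addLeft c) with hA
  have hA' : (fun x => c + L x) = A := rfl
  have hm : (μ.map L).map (c + ·) = μ.map A := by
    rw [Measure.map_map (by fun_prop) (by fun_prop)]; rfl
  -- The image of a Haar measure is a Haar measure, hence a multiple of ν. The constant k cancels in
  -- the normalisation.
  obtain ⟨k, hk0, hkt, hk⟩ : ∃ k : ENNReal, k ≠ 0 ∧ k ≠ ⊤ ∧ μ.map A = k • ν := by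
    rw [← hm, map_add_left_eq_self]
    refine ⟨(μ.map L).addHaarScalarFactor ν, ?_, ENNReal.coe_ne_top, ?_⟩
    · exact ENNReal.coe_ne_zero.2 (Measure.addHaarScalarFactor_pos_of_isAddHaarMeasure _ _).ne'
    · exact Measure.isAddLeftInvariant_eq_smul _ _
  rw [hA']
  have hsm : MeasurableSet (A '' s) :=
    A.toMeasurableEquiv.measurableEmbedding.measurableSet_image.2 hs
  have hpre : A ⁻¹' (A '' s) = s := A.injective.preimage_image s
  have hr : (μ.restrict s).map A = k • ν.restrict (A '' s) := by
    rw [← Measure.restrict_smul, ← hk, Measure.restrict_map A.measurable hsm, hpre]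
  have hv : μ s = k * ν (A '' s) := by
    have := congrArg (fun m => m (A '' s)) hk
    simpa [Measure.map_apply A.measurable hsm, hpre] using this
  rw [ProbabilityTheory.cond, ProbabilityTheory.cond, Measure.map_smul, hr, smul_smul, hv,
    ENNReal.mul_inv (Or.inl hk0) (Or.inl hkt), mul_right_comm, ENNReal.inv_mul_cancel hk0 hkt,
    one_mul]

theorem hexDir_zero : hexDir 0 = !₂[1, 0] := by simp [hexDir]

theorem hexDir_two : hexDir 2 = !₂[-(1 / 2), √3 / 2] := by
  have h : ((2 : ℕ) : ℝ) * (π / 3) = π - π / 3 := by push_cast; ring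
  rw [hexDir, h, cos_pi_sub, sin_pi_sub, cos_pi_div_three, sin_pi_div_three]

theorem hexDir_four : hexDir 4 = !₂[-(1 / 2), -(√3 / 2)] := by
  have h : ((4 : ℕ) : ℝ) * (π / 3) = π / 3 + π := by push_cast; ring
  rw [hexDir, h, cos_add_pi, sin_add_pi, cos_pi_div_three, sin_pi_div_three]

/-- The linear isomorphism from the coordinate plane with prescribed linearly independent images
of the two coordinate vectors. -/
def frame (v w : Plane) (h : v 0 * w 1 - v 1 * w 0 ≠ 0) : (ℝ × ℝ) ≃L[ℝ] Plane :=
  LinearEquiv.toContinuousLinearEquiv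
    { toFun := fun p => p.1 • v + p.2 • w
      map_add' := fun p q => by simp only [Prod.fst_add, Prod.snd_add]; module
      map_smul' := fun a p => by
        simp only [Prod.smul_fst, Prod.smul_snd, smul_eq_mul, RingHom.id_apply]; module
      invFun := fun x => ((x 0 * w 1 - x 1 * w 0) / (v 0 * w 1 - v 1 * w 0),
        (v 0 * x 1 - v 1 * x 0) / (v 0 * w 1 - v 1 * w 0))
      left_inv := fun p => by
        ext <;> simp <;> rw [div_eq_iff h] <;> ring
      right_inv := fun x => by
        ext i
        fin_cases i <;> simp <;>
          rw [div_mul_eq_mul_div, div_mul_eq_mul_div, ← add_div, div_eq_iff h] <;> ring }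

theorem frame_apply (v w : Plane) (h : v 0 * w 1 - v 1 * w 0 ≠ 0) (p : ℝ × ℝ) :
    frame v w h p = p.1 • v + p.2 • w := rfl

theorem hexDir_independent (k : ℕ) :
    hexDir k 0 * hexDir (k + 2) 1 - hexDir k 1 * hexDir (k + 2) 0 ≠ 0 := by
  have h : sin (((k + 2 : ℕ) : ℝ) * (π / 3) - k * (π / 3)) = √3 / 2 := by
    rw [← sin_pi_div_three, ← sin_pi_sub]
    congr 1
    push_cast
    ring
  rw [sin_sub] at h
  have h3 : √3 / 2 ≠ 0 := by positivity
  contrapose! h3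
  rw [← h, ← h3]
  simp [hexDir]
  ring

/-- The unit square. -/
abbrev unitSquare : Set (ℝ × ℝ) := Set.Icc 0 1 ×ˢ Set.Icc 0 1

theorem measurableSet_unitSquare : MeasurableSet unitSquare :=
  measurableSet_Icc.prod measurableSet_Icc

theorem volume_unitSquare : volume unitSquare = 1 := by
  rw [Measure.volume_eq_prod, Measure.prod_prod]
  simp

theorem hexRhombus_eq_image (c : Plane) (k : ℕ) :
    hexRhombus c k = (fun p => c + frame _ _ (hexDir_independent k) p) '' unitSquare := by
  have : parallelepiped ![hexDir k, hexDir (k + 2)] =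
      frame _ _ (hexDir_independent k) '' unitSquare := by
    ext x
    rw [mem_parallelepiped_iff]
    simp only [Fin.sum_univ_two, Set.mem_image, frame_apply]
    constructor
    · rintro ⟨t, ht, rfl⟩
      exact ⟨(t 0, t 1), ⟨⟨ht.1 0, ht.2 0⟩, ⟨ht.1 1, ht.2 1⟩⟩, rfl⟩
    · rintro ⟨p, hp, rfl⟩
      refine ⟨![p.1, p.2], ⟨fun i => ?_, fun i => ?_⟩, rfl⟩
      · fin_cases i
        exacts [hp.1.1, hp.2.1]
      · fin_cases i
        exacts [hp.1.2, hp.2.2]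
  rw [hexRhombus, this, Set.image_image]

theorem measurableSet_hexRhombus (c : Plane) (k : ℕ) : MeasurableSet (hexRhombus c k) := by
  rw [hexRhombus_eq_image]
  exact ((isCompact_Icc.prod isCompact_Icc).image (by fun_prop)).measurableSet

theorem cond_hexRhombus (c : Plane) (k : ℕ) :
    ProbabilityTheory.cond volume (hexRhombus c k) =
      (volume.restrict unitSquare).map
        fun p => c + (p.1 • hexDir k + p.2 • hexDir (k + 2)) := by
  rw [hexRhombus_eq_image, cond_image_affine volume volume _ c measurableSet_unitSquare,
    ProbabilityTheory.cond, volume_unitSquare, inv_one, one_smul]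
  rfl

/-- By the Mazur–Ulam theorem an isometry of the plane is affine, so the affine case applies. -/
theorem cond_isometry_image (φ : Plane ≃ᵢ Plane) {s : Set Plane} (hs : MeasurableSet s) :
    ProbabilityTheory.cond volume (φ '' s) = (ProbabilityTheory.cond volume s).map φ := by
  have h : (φ : Plane → Plane) =
      fun x => φ 0 + φ.toRealLinearIsometryEquiv.toContinuousLinearEquiv x := by
    ext1 x
    simp
  rw [h]
  exact cond_image_affine volume volume _ _ hs

/-! ### The law of the distance -/

theorem dist_rhombus_points (p q : ℝ × ℝ) :
    dist (center₁ + (p.1 • hexDir 0 + p.2 • hexDir 2))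
      (center₂ + (q.1 • hexDir 2 + q.2 • hexDir 4)) =
      √((1 + (1 - q.2 + p.1) / 2 + (q.1 - p.2)) ^ 2 + 3 / 4 * (p.1 - 1 + q.2) ^ 2) := by
  have h3 : √3 * √3 = 3 := mul_self_sqrt (by norm_num)
  rw [EuclideanSpace.dist_eq, Fin.sum_univ_two, hexDir_zero, hexDir_two, hexDir_four, center₁,
    center₂]
  congr 1
  simp only [Real.dist_eq, sq_abs]
  simp
  -- The vertical component of X - Y is √3/2 times the squared factor.
  linear_combination (p.2 - 2 - q.1 + q.2) ^ 2 / 4 * h3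

theorem lintegral_dist_unitSquare {g : ℝ → ENNReal} (hg : Measurable g) :
    ∫⁻ z, g (dist (center₁ + (z.1.1 • hexDir 0 + z.1.2 • hexDir 2))
      (center₂ + (z.2.1 • hexDir 2 + z.2.2 • hexDir 4)))
      ∂(((volume : Measure (ℝ × ℝ)).restrict unitSquare).prod (volume.restrict unitSquare)) =
      ∫⁻ r, ENNReal.ofReal (densityDI r) * g r := by
  simp only [dist_rhombus_points]
  have hU : (volume : Measure (ℝ × ℝ)).restrict unitSquare =
      (volume.restrict (Set.Icc 0 1)).prod (volume.restrict (Set.Icc 0 1)) := by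
    rw [Measure.prod_restrict, Measure.volume_eq_prod]
  have hm : Measurable fun z : (ℝ × ℝ) × ℝ × ℝ => g √((1 + (1 - z.2.2 + z.1.1) / 2 +
      (z.2.1 - z.1.2)) ^ 2 + 3 / 4 * (z.1.1 - 1 + z.2.2) ^ 2) := by fun_prop
  rw [lintegral_prod_symm' _ hm, hU, lintegral_prod_symm' _ hm.lintegral_prod_left',
    ← lintegral_coordinates hg]
  refine lintegral_congr fun t => ?_
  have hm' : Measurable fun y : (ℝ × ℝ) × ℝ => g √((1 + (1 - t + y.1.1) / 2 +
      (y.2 - y.1.2)) ^ 2 + 3 / 4 * (y.1.1 - 1 + t) ^ 2) := by fun_prop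
  refine (lintegral_lintegral_swap (f := fun (s : ℝ) (p : ℝ × ℝ) => g √((1 + (1 - t + p.1) / 2 +
      (s - p.2)) ^ 2 + 3 / 4 * (p.1 - 1 + t) ^ 2)) (by fun_prop)).trans ?_
  rw [lintegral_prod _ hm'.lintegral_prod_right'.aemeasurable]
  refine lintegral_congr fun a => ?_
  exact lintegral_lintegral_swap (by fun_prop)

theorem map_dist {Ω : Type*} [MeasurableSpace Ω] (P : Measure Ω) [IsProbabilityMeasure P]
    (φ : Plane ≃ᵢ Plane) (X Y : Ω → Plane) (hXm : AEMeasurable X P) (hYm : AEMeasurable Y P)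
    (hX : pdf.IsUniform X (φ '' rhombusD) P volume)
    (hY : pdf.IsUniform Y (φ '' rhombusI) P volume)
    (hXY : IndepFun X Y P) :
    P.map (fun ω => dist (X ω) (Y ω)) =
      volume.withDensity (fun d => ENNReal.ofReal (densityDI d)) := by
  have hφ : Measurable φ := φ.continuous.measurable
  have hf : ∀ (c : Plane) (k : ℕ),
      Measurable fun p : ℝ × ℝ => φ (c + (p.1 • hexDir k + p.2 • hexDir (k + 2))) :=
    fun c k => hφ.comp (by fun_prop)
  have hlaw : ∀ (c : Plane) (k : ℕ), ProbabilityTheory.cond volume (φ '' hexRhombus c k) =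
      (volume.restrict unitSquare).map
        fun p : ℝ × ℝ => φ (c + (p.1 • hexDir k + p.2 • hexDir (k + 2))) := fun c k => by
    rw [cond_isometry_image φ (measurableSet_hexRhombus c k), cond_hexRhombus,
      Measure.map_map hφ (by fun_prop)]
    rfl
  have hjoint : P.map (fun ω => (X ω, Y ω)) =
      (((volume : Measure (ℝ × ℝ)).restrict unitSquare).prod (volume.restrict unitSquare)).map
        (Prod.map (fun p => φ (center₁ + (p.1 • hexDir 0 + p.2 • hexDir 2)))
          fun q => φ (center₂ + (q.1 • hexDir 2 + q.2 • hexDir 4))) := by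
    rw [(indepFun_iff_map_prod_eq_prod_map_map hXm hYm).1 hXY, hX, hY, rhombusD, rhombusI, hlaw,
      hlaw]
    exact Measure.map_prod_map _ _ (hf _ 0) (hf _ 2)
  have hdist : P.map (fun ω => dist (X ω) (Y ω)) =
      (P.map fun ω => (X ω, Y ω)).map fun z => dist z.1 z.2 :=
    (AEMeasurable.map_map_of_aemeasurable (g := fun z : Plane × Plane => dist z.1 z.2)
      (by fun_prop) (hXm.prodMk hYm)).symm
  have hmeas : Measurable fun z : (ℝ × ℝ) × ℝ × ℝ =>
      dist (center₁ + (z.1.1 • hexDir 0 + z.1.2 • hexDir 2))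
        (center₂ + (z.2.1 • hexDir 2 + z.2.2 • hexDir 4)) := by fun_prop
  rw [hdist, hjoint, Measure.map_map (by fun_prop) ((hf _ 0).prodMap (hf _ 2))]
  ext s hs
  -- The isometry drops out here because only distances matter.
  have hpull : ((fun z : Plane × Plane => dist z.1 z.2) ∘
      Prod.map (fun p : ℝ × ℝ => φ (center₁ + (p.1 • hexDir 0 + p.2 • hexDir 2)))
        fun q : ℝ × ℝ => φ (center₂ + (q.1 • hexDir 2 + q.2 • hexDir 4))) =
      fun z => dist (center₁ + (z.1.1 • hexDir 0 + z.1.2 • hexDir 2))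
        (center₂ + (z.2.1 • hexDir 2 + z.2.2 • hexDir 4)) := by
    ext z
    exact φ.isometry.dist_eq _ _
  have hI : Measurable (s.indicator (1 : ℝ → ENNReal)) := measurable_one.indicator hs
  rw [hpull, ← lintegral_indicator_one hs, lintegral_map hI hmeas, lintegral_dist_unitSquare hI,
    withDensity_apply _ hs, ← lintegral_indicator hs]
  refine lintegral_congr fun r => ?_
  by_cases h : r ∈ s <;> simp [h]

theorem measurable_densityDI : Measurable densityDI := by
  unfold densityDI
  refine Measurable.mul (by fun_prop) ?_
  refine Measurable.ite (measurableSet_lt (by fun_prop) (by fun_prop)) (by fun_prop) ?_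
  repeat' refine Measurable.ite (measurableSet_le (by fun_prop) (by fun_prop)) ?_ ?_
  all_goals fun_prop

/-- A map that is not a.e. measurable has zero push-forward by convention, whereas a uniform law has
mass 1. -/
theorem aemeasurable_of_isUniform_hexRhombus {Ω : Type*} [MeasurableSpace Ω] {P : Measure Ω}
    [IsProbabilityMeasure P] (φ : Plane ≃ᵢ Plane) (c : Plane) (k : ℕ) {X : Ω → Plane}
    (hX : pdf.IsUniform X (φ '' hexRhombus c k) P volume) : AEMeasurable X P := by
  by_contra h
  have h1 : P.map X Set.univ = 1 := by
    rw [hX, cond_isometry_image φ (measurableSet_hexRhombus c k), cond_hexRhombus,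
      Measure.map_apply φ.continuous.measurable .univ, Set.preimage_univ,
      Measure.map_apply (by fun_prop) .univ, Set.preimage_univ, Measure.restrict_apply_univ,
      volume_unitSquare]
  rw [Measure.map_of_not_aemeasurable h] at h1
  simp at h1

end HexDist

end

theorem mainTheorem5 {Ω : Type*} [MeasurableSpace Ω] (P : Measure Ω) [IsProbabilityMeasure P]
    (φ : HexDist.Plane ≃ᵢ HexDist.Plane) (X Y : Ω → HexDist.Plane)
    (hX : pdf.IsUniform X (φ '' HexDist.rhombusD) P volume)
    (hY : pdf.IsUniform Y (φ '' HexDist.rhombusI) P volume)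
    (hXY : IndepFun X Y P) :
    (∀ d : ℝ, 0 ≤ HexDist.densityDI d) ∧
    HasPDF (fun ω => dist (X ω) (Y ω)) P volume ∧
    P.map (fun ω => dist (X ω) (Y ω)) =
      volume.withDensity (fun d => ENNReal.ofReal (HexDist.densityDI d)) := by
  have hXm := HexDist.aemeasurable_of_isUniform_hexRhombus φ HexDist.center₁ 0 hX
  have hYm := HexDist.aemeasurable_of_isUniform_hexRhombus φ HexDist.center₂ 2 hY
  have hmap := HexDist.map_dist P φ X Y hXm hYm hX hY hXY
  exact ⟨HexDist.densityDI_nonneg, hasPDF_of_map_eq_withDensity (hXm.dist hYm) _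
    HexDist.measurable_densityDI.ennreal_ofReal.aemeasurable hmap, hmap⟩
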